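/- Let $\Omega\subset\mathbb R^3$ be a bounded open set with Lipschitz boundary, let $\mathbb M$ be the space of symmetric real $3\times3$ matrices with the Frobenius scalar product $A:B$ and norm, and let $K=\{Q\in\mathbb M:\ Q\ge 0,\ \operatorname{tr}Q=1\}$. Let $f:S^2\times S^2\to\mathbb R$ be bounded with $f(u,v)=f(v,u)$ and $f(u,-v)=f(u,v)$ for all $u,v\in S^2$. For a finite set $S\subset\mathbb Z^3$ and $u:S\to S^2$ put $$E(u,S)=\sum_{i,j\in S,\ |i-j|=1} f(u_i,u_j)+\frac14\sum_{i,j\in S,\ |i-j|=\sqrt2} f(u_i,u_j),$$ where the sums run over ordered pairs $(i,j)$. Let $W=[-\tfrac12,\tfrac12)^3$ and, for $\varepsilon>0$, $\mathbb Z_\varepsilon(\Omega)=\{i\in\mathbb Z^3:\varepsilon i\in\Omega\}$. For $Q\in L^\infty(\Omega;\mathbb M)$ set $F_\varepsilon(Q)=\varepsilon^3E(u,\mathbb Z_\varepsilon(\Omega))$ if $Q(x)\in\{v\otimes v: v\in S^2\}$ for a.e. $x\in\Omega$ and there is $u:\mathbb Z_\varepsilon(\Omega)\to S^2$ such that, for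 every $i\in\mathbb Z_\varepsilon(\Omega)$, $Q(x)=u_i\otimes u_i$ for a.e. $x\in\Omega\cap\varepsilon(i+W)$ (the value does not depend on the choice of $u$); otherwise set $F_\varepsilon(Q)=+\infty$. For $Q\in\mathbb M$ let $$\hat f(Q)=\inf\Big\{\sum_{1\le i<j\le4}f(u_i,u_j):\ u_1,\dots,u_4\in S^2,\ \tfrac14\sum_{i=1}^4u_i\otimes u_i=Q\Big\}\in\mathbb R\cup\{+\infty\}$$ (with $\inf\emptyset=+\infty$), and let $\hat f^{**}$ be its convex lower semicontinuous envelope, that is, the largest convex lower semicontinuous function $\mathbb M\to[-\infty,+\infty]$ that is $\le\hat f$. Then: 1. $\hat f^{**}$ is finite on $K$, and $x\mapsto\hat f^{**}(Q(x))$ is integrable on $\Omega$ for every $Q\in L^\infty(\Omega;K)$. 2. As $\varepsilon\to0^+$, $F_\varepsilon$ $\Gamma$-converges with respect to the weak* convergence of $L^\infty(\Omega;\mathbb M)$ to $$F(Q)=\begin{cases}\dfrac32\displaystyle\int_\Omega\hat f^{**}(Q(x))\,dx&\text{if }Q\in L^\infty(\Omega;K),\\ +\infty&\text{otherwise.}\end{cases}$$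 That is, for every sequence $\varepsilon_n\to0$ with $\varepsilon_n>0$ and every $Q\in L^\infty(\Omega;\mathbb M)$: $F(Q)\le\liminf_nF_{\varepsilon_n}(Q_n)$ whenever $Q_n\rightharpoonup Q$ weakly*, and there is a sequence $Q_n\rightharpoonup Q$ weakly* with $\limsup_nF_{\varepsilon_n}(Q_n)\le F(Q)$. 3. For every $Q\in K$, the homogenized density $$f_{\rm hom}(Q)=\lim_{\rho\to0^+}\ \lim_{h\to+\infty}\frac1{h^3}\inf\Big\{E(u,\mathbb Z^3\cap hW):\ u:\mathbb Z^3\cap hW\to S^2,\ \Big|\frac1{\#(\mathbb Z^3\cap hW)}\sum_{i\in\mathbb Z^3\cap hW}u_i\otimes u_i-Q\Big|\le\rho\Big\}$$ ($h$ real, both limits existing) satisfies $f_{\rm hom}(Q)=\frac32\hat f^{**}(Q)$. -/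

import Mathlib

open MeasureTheory Filter Topology

noncomputable section

namespace QTensor

/-- Euclidean three-space. -/
abbrev E3 : Type := EuclideanSpace ℝ (Fin 3)

/-- The cubic lattice of integer points. -/
abbrev Z3 : Type := Fin 3 → ℤ

/-- The unit sphere of Euclidean three-space. -/
abbrev S2 : Type := Metric.sphere (0 : E3) 1

/-- The symmetric real `3 × 3` matrices. -/
def symMatrices : Submodule ℝ (Matrix (Fin 3) (Fin 3) ℝ) where
  carrier := {A | A.IsSymm}
  add_mem' := fun ha hb => ha.add hb
  zero_mem' := Matrix.isSymm_zero
  smul_mem' := fun c _ ha => ha.smul c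

/-- The space of symmetric real `3 × 3` matrices with the Frobenius norm. -/
def Sym3 : Type := symMatrices

instance : NormedAddCommGroup Sym3 :=
  letI : NormedAddCommGroup (Matrix (Fin 3) (Fin 3) ℝ) := Matrix.frobeniusNormedAddCommGroup
  inferInstanceAs (NormedAddCommGroup symMatrices)

instance : NormedSpace ℝ Sym3 :=
  letI : NormedAddCommGroup (Matrix (Fin 3) (Fin 3) ℝ) := Matrix.frobeniusNormedAddCommGroup
  letI : NormedSpace ℝ (Matrix (Fin 3) (Fin 3) ℝ) := Matrix.frobeniusNormedSpace
  inferInstanceAs (NormedSpace ℝ symMatrices)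

/-- The Frobenius scalar product `A : B`. -/
def frob (A B : Sym3) : ℝ := ∑ k, ∑ l, A.1 k l * B.1 k l

theorem norm_sq_eq_frob (A : Sym3) : ‖A‖ ^ 2 = frob A A := by
  have h : ‖A‖ = (∑ k, ∑ l, ‖A.1 k l‖ ^ (2 : ℝ)) ^ (1 / 2 : ℝ) := Matrix.frobenius_norm_def A.1
  rw [h, ← Real.sqrt_eq_rpow, Real.sq_sqrt (by positivity)]
  simp [frob, sq]

/-- The tensor `u ⊗ u` of a unit vector. -/
def tensor (u : S2) : Sym3 :=
  ⟨Matrix.of fun k l => u.1 k * u.1 l, by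
    ext k l
    simp [mul_comm]⟩

/-- Symmetric positive semidefinite matrices of trace one. -/
def K : Set Sym3 := {Q | Q.1.PosSemidef ∧ Q.1.trace = 1}

/-- `Ω` has Lipschitz boundary: near each boundary point, and in suitable orthonormal
coordinates, `Ω` is the region above the graph of a Lipschitz function. -/
def HasLipschitzBoundary (Ω : Set E3) : Prop :=
  ∀ x ∈ frontier Ω, ∃ r : ℝ, 0 < r ∧ ∃ (T : E3 ≃ₗᵢ[ℝ] E3) (C : NNReal) (γ : ℝ × ℝ → ℝ),
    LipschitzWith C γ ∧
      ∀ z ∈ Metric.ball x r, (z ∈ Ω ↔ γ (T z 0, T z 1) < T z 2)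

/-- The point `ε i` of the scaled lattice. -/
def latticePoint (ε : ℝ) (i : Z3) : E3 := WithLp.toLp 2 fun k => ε * (i k : ℝ)

/-- The indices `i` with `ε i ∈ A`. -/
def latticeIn (ε : ℝ) (A : Set E3) : Set Z3 := {i | latticePoint ε i ∈ A}

/-- The half-open cube `h [-1/2, 1/2)³`. -/
def cube (h : ℝ) : Set E3 := {x | ∀ k, -(h / 2) ≤ x k ∧ x k < h / 2}

/-- The cell `ε (i + [-1/2, 1/2)³)`. -/
def cell (ε : ℝ) (i : Z3) : Set E3 := {x | x - latticePoint ε i ∈ cube ε}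

/-- Ordered pairs of points of `S` whose Euclidean distance has square `d`. -/
def bonds (d : ℤ) (S : Set Z3) : Set (Z3 × Z3) :=
  {p | p.1 ∈ S ∧ p.2 ∈ S ∧ ∑ k, (p.1 k - p.2 k) ^ 2 = d}

/-- The unscaled energy of the spin field `u` on a finite set `S` of lattice points: ordered
nearest neighbours with potential `f`, ordered next-to-nearest neighbours with potential `f/4`. -/
def latticeEnergy (f : S2 → S2 → ℝ) (S : Set Z3) (u : Z3 → S2) : ℝ :=
  (∑ᶠ p ∈ bonds 1 S, f (u p.1) (u p.2)) + (1 / 4) * ∑ᶠ p ∈ bonds 2 S, f (u p.1) (u p.2)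

/-- The space `L^∞(Ω; Sym3)`. -/
abbrev LInf (Ω : Set E3) : Type := Lp Sym3 ⊤ (volume.restrict Ω)

/-- `Q` takes values of the form `v ⊗ v` a.e. in `Ω`, and equals `u i ⊗ u i` on the part in `Ω`
of each cell `ε (i + [-1/2, 1/2)³)` with `ε i ∈ Ω`: that is, `Q` is the piecewise constant
interpolation of the spin field `u`. -/
def Interpolates (Ω : Set E3) (ε : ℝ) (u : Z3 → S2) (Q : LInf Ω) : Prop :=
  (∀ᵐ x ∂(volume.restrict Ω), ∃ v : S2, Q x = tensor v) ∧
    ∀ i ∈ latticeIn ε Ω, ∀ᵐ x ∂(volume.restrict Ω), x ∈ cell ε i → Q x = tensor (u i)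

/-- The discrete energy as a functional on `L^∞(Ω; Sym3)`. It is `⊤` unless `Q` interpolates a
spin field; the values `u i`, `i ∈ latticeIn ε Ω`, of this field are then determined up to sign,
so that for `f` even in each variable the infimum is over a constant family. -/
def discreteEnergy (f : S2 → S2 → ℝ) (Ω : Set E3) (ε : ℝ) (Q : LInf Ω) : EReal :=
  ⨅ (u : Z3 → S2) (_ : Interpolates Ω ε u Q),
    ((ε ^ 3 * latticeEnergy f (latticeIn ε Ω) u : ℝ) : EReal)

/-- The infimum of `∑_{i<j} f (u i) (u j)` over quadruples of unit vectors with
`(1/4) ∑ u i ⊗ u i = Q` (`⊤` if there are none). -/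
def fHat (f : S2 → S2 → ℝ) (Q : Sym3) : EReal :=
  ⨅ (u : Fin 4 → S2) (_ : (1 / 4 : ℝ) • ∑ i, tensor (u i) = Q),
    ((∑ i, ∑ j ∈ Finset.Ioi i, f (u i) (u j) : ℝ) : EReal)

/-- Convexity of an extended-real-valued function, by its epigraph. -/
def EConvex (g : Sym3 → EReal) : Prop := Convex ℝ {p : Sym3 × ℝ | g p.1 ≤ (p.2 : EReal)}

/-- The convex lower semicontinuous envelope `g**`: the largest convex lower semicontinuous
function below `g`. -/
def envelope (g : Sym3 → EReal) (Q : Sym3) : EReal :=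
  ⨆ (φ : Sym3 → EReal) (_ : EConvex φ ∧ LowerSemicontinuous φ ∧ ∀ P, φ P ≤ g P), φ Q

/-- Weak* convergence of a sequence in `L^∞(Ω; Sym3)`, as the dual of `L^1(Ω; Sym3)`. -/
def WeakStarConv (Ω : Set E3) (Qs : ℕ → LInf Ω) (Q : LInf Ω) : Prop :=
  ∀ φ : E3 → Sym3, IntegrableOn φ Ω volume →
    Tendsto (fun n => ∫ x in Ω, frob (φ x) (Qs n x)) atTop (𝓝 (∫ x in Ω, frob (φ x) (Q x)))

/-- Gamma-convergence, as `ε → 0⁺`, of the functionals `F ε` on `X` to `F₀`, with respect to the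
notion `conv` of convergence of sequences in `X`. -/
def GammaConverges {X : Type*} (conv : (ℕ → X) → X → Prop) (F : ℝ → X → EReal)
    (F₀ : X → EReal) : Prop :=
  ∀ ε : ℕ → ℝ, (∀ n, 0 < ε n) → Tendsto ε atTop (𝓝 0) →
    (∀ (x : X) (xs : ℕ → X), conv xs x → F₀ x ≤ liminf (fun n => F (ε n) (xs n)) atTop) ∧
    (∀ x : X, ∃ xs : ℕ → X, conv xs x ∧ limsup (fun n => F (ε n) (xs n)) atTop ≤ F₀ x)

open Classical in
/-- The limit functional: `(3/2) ∫_Ω fHat** (Q x) dx` on `L^∞(Ω; K)` and `⊤` elsewhere. -/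
def limitEnergy (f : S2 → S2 → ℝ) (Ω : Set E3) (Q : LInf Ω) : EReal :=
  if ∀ᵐ x ∂(volume.restrict Ω), Q x ∈ K then
    ((3 / 2 * ∫ x in Ω, (envelope (fHat f) (Q x)).toReal : ℝ) : EReal)
  else ⊤

/-- The average of `u ⊗ u` over the lattice points in the cube `h [-1/2, 1/2)³`. -/
def discreteAverage (u : Z3 → S2) (h : ℝ) : Sym3 :=
  ((latticeIn 1 (cube h)).ncard : ℝ)⁻¹ • ∑ᶠ i ∈ latticeIn 1 (cube h), tensor (u i)

/-- `h⁻³` times the infimum of the energy in the cube `h [-1/2, 1/2)³` over the spin fields whose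
average tensor is in the closed Frobenius ball of radius `ρ` around `Q` (`⊤` if there are none). -/
def cellInf (f : S2 → S2 → ℝ) (Q : Sym3) (ρ h : ℝ) : EReal :=
  ⨅ (u : Z3 → S2) (_ : discreteAverage u h ∈ Metric.closedBall Q ρ),
    ((latticeEnergy f (latticeIn 1 (cube h)) u / h ^ 3 : ℝ) : EReal)

/-- The homogenization formula: `lim_{ρ → 0⁺} lim_{h → ∞} cellInf f Q ρ h` exists and equals `c`. -/
def IsHomogenizedValue (f : S2 → S2 → ℝ) (Q : Sym3) (c : EReal) : Prop :=
  ∃ m : ℝ → EReal, (∀ ρ : ℝ, 0 < ρ → Tendsto (fun h : ℝ => cellInf f Q ρ h) atTop (𝓝 (m ρ))) ∧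
    Tendsto m (𝓝[>] 0) (𝓝 c)

end QTensor

end

/-!
The proof rests on one combinatorial fact about the cubic lattice. Every nearest-neighbour bond is
an edge of four unit lattice squares, and every bond of length `√2` is the diagonal of exactly one.
Since the weights of the two kinds of bonds are `1` and `1 / 4`, the energy is, up to a boundary
term, half the sum over all unit squares of the energy `pairSum f` of the four spins at the corners,
in which all six pairs count equally (`abs_latticeEnergy_sub_le`). There are three squares per
lattice site, whence the factor `3 / 2`.

*Lower bound.* The energy of a square is at least the envelope of `fHat f` at the mean tensor of its
four corners. The mean of these means over all squares based in a set is, up to a boundary term, the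
mean tensor over the set, so that Jensen's inequality bounds the energy on the set from below by the
envelope (`exists_env_le_sum_siteEnergy`). For the Gamma-liminf inequality this is applied on the
cells of a mesh, where weak* convergence identifies the limits of the mean tensors. On a fine mesh,
the envelope at the cell means nearly recovers `∫ env f (Q x)`: this holds for Lipschitz functions
because cell means converge in `L¹`, and the envelope is the increasing limit of its Lipschitz
regularizations `lipEnv` (`exists_mesh_integral_env_le`).

*Upper bound.* The epigraph of the envelope is the closed convex hull of the points above the values
of quadruples (`envelope_le_iff`). Hence it suffices that the set of the pairs `(P, t)` which are
`Recoverable` on every bounded set with negligible boundary is closed and convex, and contains those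
points. For the latter, there is a colouring of the lattice by the four elements of `(ℤ/2)²` in
which every lattice square, of any orientation, shows all four colours
(`exists_perm_square_colour`); placing the four vectors of a quadruple according to the colours
gives every square the same energy. Convexity holds because two spin fields can be used on the two
sides of a plane that splits the volume in any given ratio (`convex_recoverable`).
Recovery sequences are obtained on a mesh from the cell means of `Q`, by Jensen's inequality for
integrals and a diagonal argument.

*Homogenization.* The same two bounds on the unit cube, with `ε = 1 / h`, show that the inner limit
is `3 / 2` times the infimum of the envelope over the ball of radius `ρ`; this infimum converges to
the value at the centre as `ρ → 0`, by lower semicontinuity.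

The Lipschitz regularity of the boundary enters only through the fact that the boundary is
negligible (`null_frontier_of_hasLipschitzBoundary`), which makes all boundary terms vanish in the
limit.
-/

noncomputable section

namespace QTensor

variable {f : S2 → S2 → ℝ} {C : ℝ} {A Ω : Set E3}

/-! ### Symmetric matrices and the set `K` -/

instance : FiniteDimensional ℝ Sym3 :=
  inferInstanceAs (FiniteDimensional ℝ symMatrices)

instance : ProperSpace Sym3 := FiniteDimensional.proper ℝ Sym3
instance : CompleteSpace Sym3 := FiniteDimensional.complete ℝ Sym3

@[simp] theorem sub_entry (A B : Sym3) (k l : Fin 3) : (A - B).1 k l = A.1 k l - B.1 k l := rfl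
@[simp] theorem tensor_entry (u : S2) (k l : Fin 3) : (tensor u).1 k l = u.1 k * u.1 l := rfl
@[simp] theorem add_coe (A B : Sym3) : (A + B).1 = A.1 + B.1 := rfl
@[simp] theorem smul_coe (c : ℝ) (A : Sym3) : (c • A).1 = c • A.1 := rfl

theorem Sym3.ext {A B : Sym3} (h : ∀ k l, A.1 k l = B.1 k l) : A = B :=
  Subtype.ext (Matrix.ext h)

/-- The Frobenius scalar product as a linear functional of its second argument. -/
def frobL (A : Sym3) : Sym3 →L[ℝ] ℝ :=
  LinearMap.toContinuousLinearMap
    { toFun := frob A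
      map_add' := fun B C => by simp [frob, mul_add, Finset.sum_add_distrib]
      map_smul' := fun c B => by simp [frob, Finset.mul_sum, mul_left_comm] }

@[simp] theorem frobL_apply (A B : Sym3) : frobL A B = frob A B := rfl

theorem frob_comm (A B : Sym3) : frob A B = frob B A := by simp [frob, mul_comm]

theorem frob_add_right (A B C : Sym3) : frob A (B + C) = frob A B + frob A C :=
  (frobL A).map_add B C
theorem frob_sub_right (A B C : Sym3) : frob A (B - C) = frob A B - frob A C :=
  (frobL A).map_sub B C
theorem frob_smul_right (c : ℝ) (A B : Sym3) : frob A (c • B) = c * frob A B :=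
  (frobL A).map_smul c B
theorem frob_sub_left (A B C : Sym3) : frob (A - B) C = frob A C - frob B C := by
  rw [frob_comm, frob_sub_right, frob_comm A, frob_comm B]

theorem abs_frob_le (A B : Sym3) : |frob A B| ≤ ‖A‖ * ‖B‖ := by
  apply abs_le_of_sq_le_sq _ (by positivity)
  rw [mul_pow, norm_sq_eq_frob, norm_sq_eq_frob]
  have h := Finset.sum_mul_sq_le_sq_mul_sq (Finset.univ : Finset (Fin 3 × Fin 3))
    (fun p => A.1 p.1 p.2) (fun p => B.1 p.1 p.2)
  simp only [Fintype.sum_prod_type, sq] at h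
  simp only [frob, sq]
  exact h

theorem norm_tensor (u : S2) : ‖tensor u‖ = 1 := by
  have hu : ∑ k, u.1 k * u.1 k = 1 := by
    have h := EuclideanSpace.real_norm_sq_eq u.1
    rw [mem_sphere_zero_iff_norm.1 u.2] at h
    simpa [sq] using h.symm
  have h : ‖tensor u‖ ^ 2 = 1 := by
    rw [norm_sq_eq_frob, frob]
    calc _ = (∑ k, u.1 k * u.1 k) * ∑ l, u.1 l * u.1 l := by
          rw [Finset.sum_mul_sum]
          exact Finset.sum_congr rfl fun k _ => Finset.sum_congr rfl fun l _ => by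
            simp only [tensor_entry]; ring
      _ = 1 := by rw [hu, one_mul]
  exact (sq_eq_sq₀ (norm_nonneg _) zero_le_one).1 (by rw [h, one_pow])

theorem tensor_mem_K (u : S2) : tensor u ∈ K := by
  constructor
  · have := Matrix.posSemidef_vecMulVec_self_star (fun k => u.1 k : Fin 3 → ℝ)
    exact this
  · have h := EuclideanSpace.real_norm_sq_eq u.1
    rw [mem_sphere_zero_iff_norm.1 u.2] at h
    simp only [Matrix.trace, Matrix.diag, tensor_entry]
    simpa [sq] using h.symm

/-- The matrix `x ⊗ x` of an arbitrary vector `x`. -/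
def rankOne (x : Fin 3 → ℝ) : Sym3 :=
  ⟨Matrix.of fun k l => x k * x l, by ext; simp [mul_comm]⟩

/-- The quadratic form of a matrix, at a vector `x`. -/
def quad (x : Fin 3 → ℝ) (Q : Sym3) : ℝ := frob (rankOne x) Q

/-- The identity matrix. -/
def oneSym : Sym3 := ⟨1, Matrix.isSymm_one⟩

theorem trace_eq_frob (Q : Sym3) : Q.1.trace = frob oneSym Q := by
  simp [frob, oneSym, Matrix.trace, Matrix.one_apply]

/-- Membership in `K` by linear conditions, from which closedness, convexity and the stability
under weak* limits are read off. -/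
theorem mem_K_iff (Q : Sym3) : Q ∈ K ↔ (∀ x, 0 ≤ quad x Q) ∧ Q.1.trace = 1 := by
  rw [K, Set.mem_ofPred_eq, Matrix.posSemidef_iff_dotProduct_mulVec]
  have hq (x : Fin 3 → ℝ) : star x ⬝ᵥ Q.1.mulVec x = quad x Q := by
    simp [quad, rankOne, frob, dotProduct, Matrix.mulVec, Finset.mul_sum]
    exact Finset.sum_congr rfl fun k _ => Finset.sum_congr rfl fun l _ => by ring
  have hs : Q.1.IsHermitian := by
    rw [Matrix.IsHermitian, Matrix.conjTranspose_eq_transpose_of_trivial]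
    exact Q.2
  constructor
  · rintro ⟨⟨_, h⟩, h'⟩
    exact ⟨fun x => by rw [← hq]; exact h x, h'⟩
  · rintro ⟨h, h'⟩
    exact ⟨⟨hs, fun x => by rw [hq]; exact h x⟩, h'⟩

theorem isClosed_K : IsClosed K := by
  have : K = (⋂ x, {Q | 0 ≤ quad x Q}) ∩ {Q | frob oneSym Q = 1} := by
    ext Q; simp [mem_K_iff, trace_eq_frob]
  rw [this]
  refine (isClosed_iInter fun x => ?_).inter ?_
  · exact isClosed_le continuous_const (frobL _).continuous
  · exact isClosed_eq (frobL _).continuous continuous_const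

theorem convex_K : Convex ℝ K := by
  intro P hP Q hQ a b ha hb hab
  rw [mem_K_iff] at *
  refine ⟨fun x => ?_, ?_⟩
  · have h : quad x (a • P + b • Q) = a * quad x P + b * quad x Q := by
      rw [quad, frob_add_right, frob_smul_right, frob_smul_right, quad, quad]
    rw [h]
    exact add_nonneg (mul_nonneg ha (hP.1 x)) (mul_nonneg hb (hQ.1 x))
  · rw [add_coe, smul_coe, smul_coe, Matrix.trace_add, Matrix.trace_smul, Matrix.trace_smul,
      hP.2, hQ.2]
    simpa using hab

/-- By the spectral theorem, the matrices in `K` are the convex combinations of tensors. -/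
theorem K_eq_convexHull : K = convexHull ℝ (Set.range tensor) := by
  apply subset_antisymm _ (convexHull_min (Set.range_subset_iff.2 tensor_mem_K) convex_K)
  intro Q hQ
  have hH : Q.1.IsHermitian := hQ.1.1
  let e (j : Fin 3) : S2 := ⟨hH.eigenvectorBasis j, by simp⟩
  have hsum : ∑ j, hH.eigenvalues j • tensor (e j) = Q := by
    refine Sym3.ext fun k l => ?_
    have h := congrFun (congrFun hH.spectral_theorem k) l
    rw [Unitary.conjStarAlgAut_apply, Matrix.mul_apply] at h
    rw [h, Fin.sum_univ_three, Fin.sum_univ_three]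
    simp [Matrix.mul_diagonal, Matrix.star_apply, e]
    ring
  rw [← hsum]
  refine (convex_convexHull ℝ _).sum_mem (fun j _ => hQ.1.eigenvalues_nonneg j) ?_
    fun j _ => subset_convexHull ℝ _ ⟨_, rfl⟩
  have := hH.trace_eq_sum_eigenvalues
  rw [hQ.2] at this
  simpa using this.symm

theorem norm_le_one_of_mem_K {Q : Sym3} (hQ : Q ∈ K) : ‖Q‖ ≤ 1 := by
  rw [K_eq_convexHull] at hQ
  have h : convexHull ℝ (Set.range tensor) ⊆ Metric.closedBall 0 1 := by
    refine convexHull_min (Set.range_subset_iff.2 fun u => ?_) (convex_closedBall 0 1)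
    simp [norm_tensor]
  simpa using h hQ

/-! ### The convex envelope -/

/-- The sum of `f` over the six pairs of a quadruple of unit vectors. -/
def pairSum (f : S2 → S2 → ℝ) (u : Fin 4 → S2) : ℝ := ∑ i, ∑ j ∈ Finset.Ioi i, f (u i) (u j)

/-- The mean of the tensors of a quadruple of unit vectors. -/
def avg4 (u : Fin 4 → S2) : Sym3 := (1 / 4 : ℝ) • ∑ i, tensor (u i)

/-- The points of `Sym3 × ℝ` above the value of some quadruple. -/
def quadEpi (f : S2 → S2 → ℝ) : Set (Sym3 × ℝ) := {p | ∃ u, avg4 u = p.1 ∧ pairSum f u ≤ p.2}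

/-- The closed convex hull of `quadEpi f`. It is the epigraph of the envelope of `fHat f`. -/
def hullEpi (f : S2 → S2 → ℝ) : Set (Sym3 × ℝ) := closure (convexHull ℝ (quadEpi f))

/-- The real values of the envelope of `fHat f`. They are meaningful on `K`, where the envelope
is finite. -/
def env (f : S2 → S2 → ℝ) (Q : Sym3) : ℝ := (envelope (fHat f) Q).toReal

theorem pairSum_eq (f : S2 → S2 → ℝ) (u : Fin 4 → S2) :
    pairSum f u = f (u 0) (u 1) + f (u 0) (u 2) + f (u 0) (u 3) + f (u 1) (u 2) + f (u 1) (u 3)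
      + f (u 2) (u 3) := by
  have h0 : Finset.Ioi (0 : Fin 4) = {1, 2, 3} := by decide
  have h1 : Finset.Ioi (1 : Fin 4) = {2, 3} := by decide
  have h2 : Finset.Ioi (2 : Fin 4) = {3} := by decide
  have h3 : Finset.Ioi (3 : Fin 4) = ∅ := by decide
  rw [pairSum, Fin.sum_univ_four, h0, h1, h2, h3]
  simp
  ring

theorem abs_pairSum_le (hf : ∀ u v, |f u v| ≤ C) (u : Fin 4 → S2) : |pairSum f u| ≤ 6 * C := by
  rw [pairSum_eq, abs_le]
  have h (i j : Fin 4) := abs_le.1 (hf (u i) (u j))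
  have := h 0 1
  have := h 0 2
  have := h 0 3
  have := h 1 2
  have := h 1 3
  have := h 2 3
  constructor <;> linarith

theorem avg4_mem_K (u : Fin 4 → S2) : avg4 u ∈ K := by
  rw [avg4, Finset.smul_sum]
  exact convex_K.sum_mem (fun _ _ => by norm_num) (by simp) fun i _ => tensor_mem_K _

theorem convex_hullEpi : Convex ℝ (hullEpi f) := (convex_convexHull ℝ _).closure

theorem isClosed_hullEpi : IsClosed (hullEpi f) := isClosed_closure

theorem quadEpi_subset_hullEpi : quadEpi f ⊆ hullEpi f :=
  (subset_convexHull ℝ _).trans subset_closure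

theorem hullEpi_subset {S : Set (Sym3 × ℝ)} (hc : Convex ℝ S) (hcl : IsClosed S)
    (h : quadEpi f ⊆ S) : hullEpi f ⊆ S :=
  closure_minimal (convexHull_min h hc) hcl

theorem hullEpi_mono {P : Sym3} {s t : ℝ} (h : (P, s) ∈ hullEpi f) (hst : s ≤ t) :
    (P, t) ∈ hullEpi f := by
  have : hullEpi f ⊆ (fun p => p + ((0, t - s) : Sym3 × ℝ)) ⁻¹' hullEpi f := by
    refine hullEpi_subset ?_ ?_ ?_
    · exact convex_hullEpi.translate_preimage_left _
    · exact isClosed_hullEpi.preimage (by fun_prop)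
    · rintro ⟨R, r⟩ ⟨u, hu, hr⟩
      refine quadEpi_subset_hullEpi ⟨u, ?_, ?_⟩
      · simpa using hu
      · simp only [Prod.mk_add_mk] at hr ⊢
        linarith
  simpa using this h

theorem hullEpi_subset_prod (hf : ∀ u v, |f u v| ≤ C) :
    hullEpi f ⊆ K ×ˢ Set.Ici (-(6 * C)) := by
  refine hullEpi_subset (convex_K.prod (convex_Ici _)) (isClosed_K.prod isClosed_Ici) ?_
  rintro ⟨R, r⟩ ⟨u, rfl, hr⟩
  exact ⟨avg4_mem_K u, (abs_le.1 (abs_pairSum_le hf u)).1.trans hr⟩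

/-- The envelope is at most `6 * C` on `K`: at a tensor `v ⊗ v` the quadruple `v, v, v, v` is
admissible, and these tensors span `K` as a convex set. -/
theorem mk_mem_hullEpi (hf : ∀ u v, |f u v| ≤ C) {P : Sym3} (hP : P ∈ K) :
    (P, 6 * C) ∈ hullEpi f := by
  have h : K ⊆ {P | (P, 6 * C) ∈ hullEpi f} := by
    rw [K_eq_convexHull]
    refine convexHull_min ?_ ?_
    · rintro _ ⟨u, rfl⟩
      refine quadEpi_subset_hullEpi ⟨fun _ => u, ?_, (le_abs_self _).trans (abs_pairSum_le hf _)⟩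
      simp only [avg4, Finset.sum_const, Finset.card_univ, Fintype.card_fin]
      rw [← Nat.cast_smul_eq_nsmul ℝ, smul_smul]
      norm_num
    · intro P hP Q hQ a b ha hb hab
      have := convex_hullEpi hP hQ ha hb hab
      simpa [← add_mul, hab] using this
  exact h hP

/-- The epigraph of the envelope of `fHat f` is `hullEpi f`. -/
theorem envelope_le_iff (hf : ∀ u v, |f u v| ≤ C) (P : Sym3) (t : ℝ) :
    envelope (fHat f) P ≤ t ↔ (P, t) ∈ hullEpi f := by
  constructor
  · -- The function with epigraph `hullEpi f` competes in the definition of the envelope.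
    let φ : Sym3 → EReal := fun P => ⨅ (t : ℝ) (_ : (P, t) ∈ hullEpi f), (t : EReal)
    have hφ (P : Sym3) (t : ℝ) : φ P ≤ t ↔ (P, t) ∈ hullEpi f := by
      refine ⟨fun h => ?_, fun h => iInf₂_le t h⟩
      have hlim : Tendsto (fun n : ℕ => (P, t + 1 / ((n : ℝ) + 1))) atTop (𝓝 (P, t)) := by
        refine tendsto_const_nhds.prodMk_nhds ?_
        simpa using tendsto_one_div_add_atTop_nhds_zero_nat.const_add t
      refine isClosed_hullEpi.mem_of_tendsto hlim (Eventually.of_forall fun n => ?_)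
      have hlt : φ P < ((t + 1 / ((n : ℝ) + 1) : ℝ) : EReal) :=
        h.trans_lt (EReal.coe_lt_coe_iff.2 (by linarith [Nat.one_div_pos_of_nat (α := ℝ) (n := n)]))
      obtain ⟨s, hs⟩ := iInf_lt_iff.1 hlt
      obtain ⟨hs, hs'⟩ := iInf_lt_iff.1 hs
      exact hullEpi_mono hs (EReal.coe_lt_coe_iff.1 hs').le
    have hlow (P : Sym3) : ((-(6 * C) : ℝ) : EReal) ≤ φ P :=
      le_iInf₂ fun t ht => EReal.coe_le_coe_iff.2 (hullEpi_subset_prod hf ht).2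
    have hcomp : EConvex φ ∧ LowerSemicontinuous φ ∧ ∀ P, φ P ≤ fHat f P := by
      refine ⟨?_, ?_, fun P => ?_⟩
      · have : {p : Sym3 × ℝ | φ p.1 ≤ (p.2 : EReal)} = hullEpi f := by
          ext p; exact hφ _ _
        rw [EConvex, this]
        exact convex_hullEpi
      · rw [lowerSemicontinuous_iff_isClosed_preimage]
        intro y
        induction y with
        | bot =>
          have : φ ⁻¹' Set.Iic ⊥ = ∅ := by
            ext P
            simp only [Set.mem_preimage, Set.mem_Iic, le_bot_iff, Set.mem_empty_iff_false,
              iff_false]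
            intro h
            have := hlow P
            rw [h, le_bot_iff] at this
            exact EReal.coe_ne_bot _ this
          rw [this]
          exact isClosed_empty
        | coe t =>
          have : φ ⁻¹' Set.Iic (t : EReal) = (fun P => (P, t)) ⁻¹' hullEpi f := by
            ext P; exact hφ P t
          rw [this]
          exact isClosed_hullEpi.preimage (by fun_prop)
        | top => simp
      · refine le_iInf₂ fun u hu => ?_
        exact (hφ _ _).2 (quadEpi_subset_hullEpi ⟨u, hu, le_rfl⟩)
    exact fun h => (hφ P t).1 ((le_iSup₂ (f := fun (φ : Sym3 → EReal) _ => φ P) φ hcomp).trans h)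
  · intro h
    refine iSup₂_le fun φ hφ => ?_
    have hcl : IsClosed {p : Sym3 × ℝ | φ p.1 ≤ (p.2 : EReal)} :=
      hφ.2.1.isClosed_epigraph.preimage
        (f := fun p : Sym3 × ℝ => (p.1, (p.2 : EReal)))
        (continuous_fst.prodMk (continuous_coe_real_ereal.comp continuous_snd))
    refine hullEpi_subset hφ.1 hcl ?_ h
    rintro ⟨R, r⟩ ⟨u, hu, hr⟩
    refine (hφ.2.2 R).trans ((iInf₂_le u hu).trans ?_)
    exact EReal.coe_le_coe_iff.2 hr

theorem envelope_ne_bot (hf : ∀ u v, |f u v| ≤ C) (P : Sym3) : envelope (fHat f) P ≠ ⊥ := by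
  intro h
  have h1 : envelope (fHat f) P ≤ ((-(6 * C) - 1 : ℝ) : EReal) := by rw [h]; exact bot_le
  have h2 := (hullEpi_subset_prod hf ((envelope_le_iff hf P _).1 h1)).2
  simp only [Set.mem_Ici] at h2
  linarith

theorem envelope_ne_top (hf : ∀ u v, |f u v| ≤ C) {P : Sym3} (hP : P ∈ K) :
    envelope (fHat f) P ≠ ⊤ :=
  (((envelope_le_iff hf P _).2 (mk_mem_hullEpi hf hP)).trans_lt (EReal.coe_lt_top _)).ne

theorem coe_env (hf : ∀ u v, |f u v| ≤ C) {P : Sym3} (hP : P ∈ K) :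
    (env f P : EReal) = envelope (fHat f) P :=
  EReal.coe_toReal (envelope_ne_top hf hP) (envelope_ne_bot hf P)

theorem mem_hullEpi_iff (hf : ∀ u v, |f u v| ≤ C) {P : Sym3} {t : ℝ} :
    (P, t) ∈ hullEpi f ↔ P ∈ K ∧ env f P ≤ t := by
  constructor
  · intro h
    have hP : P ∈ K := (hullEpi_subset_prod hf h).1
    refine ⟨hP, ?_⟩
    rw [← EReal.coe_le_coe_iff, coe_env hf hP]
    exact (envelope_le_iff hf P t).2 h
  · rintro ⟨hP, h⟩
    rw [← envelope_le_iff hf, ← coe_env hf hP]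
    exact EReal.coe_le_coe_iff.2 h

theorem abs_env_le (hf : ∀ u v, |f u v| ≤ C) {P : Sym3} (hP : P ∈ K) : |env f P| ≤ 6 * C := by
  refine abs_le.2 ⟨?_, ((mem_hullEpi_iff hf).1 (mk_mem_hullEpi hf hP)).2⟩
  exact (hullEpi_subset_prod hf ((mem_hullEpi_iff hf).2 ⟨hP, le_rfl⟩)).2

theorem env_avg4_le (hf : ∀ u v, |f u v| ≤ C) (u : Fin 4 → S2) : env f (avg4 u) ≤ pairSum f u :=
  ((mem_hullEpi_iff hf).1 (quadEpi_subset_hullEpi ⟨u, rfl, le_rfl⟩)).2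

theorem convexOn_env (hf : ∀ u v, |f u v| ≤ C) : ConvexOn ℝ K (env f) := by
  refine ⟨convex_K, fun P hP Q hQ a b ha hb hab => ?_⟩
  have := convex_hullEpi ((mem_hullEpi_iff hf).2 ⟨hP, le_rfl⟩)
    ((mem_hullEpi_iff hf).2 ⟨hQ, le_rfl⟩) ha hb hab
  exact ((mem_hullEpi_iff hf).1 this).2

theorem isClosed_sublevel (hf : ∀ u v, |f u v| ≤ C) (c : ℝ) :
    IsClosed {P | P ∈ K ∧ env f P ≤ c} := by
  have : {P | P ∈ K ∧ env f P ≤ c} = (fun P => (P, c)) ⁻¹' hullEpi f := by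
    ext P; exact (mem_hullEpi_iff hf).symm
  rw [this]
  exact isClosed_hullEpi.preimage (by fun_prop)

/-- Lower semicontinuity of the envelope on `K`, in terms of distances. -/
theorem exists_lt_env_of_norm_sub_lt (hf : ∀ u v, |f u v| ≤ C) {P : Sym3} {c : ℝ}
    (hc : c < env f P) : ∃ r > 0, ∀ R ∈ K, ‖R - P‖ < r → c < env f R := by
  have hmem : P ∈ {P | P ∈ K ∧ env f P ≤ c}ᶜ := fun h => not_lt.2 h.2 hc
  obtain ⟨r, hr, h⟩ := Metric.isOpen_iff.1 (isClosed_sublevel hf c).isOpen_compl P hmem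
  refine ⟨r, hr, fun R hR hRP => ?_⟩
  by_contra hle
  exact h (mem_ball_iff_norm.2 hRP) ⟨hR, not_lt.1 hle⟩

theorem nonneg_of_bound (hf : ∀ u v, |f u v| ≤ C) : 0 ≤ C :=
  let v : S2 := ⟨EuclideanSpace.single 0 1, by simp⟩
  (abs_nonneg (f v v)).trans (hf v v)

/-! ### The lattice energy as a sum over squares -/

/-- Integer vectors with entries in `{-1, 0, 1}`. -/
def IsNbr (d : Z3) : Prop := ∀ k, |d k| ≤ 1

theorem IsNbr.neg {d : Z3} (h : IsNbr d) : IsNbr (-d) := fun k => by simpa using h k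

open Classical in
/-- The points of `S` with a neighbour, in the sense of `IsNbr`, outside `S`. -/
def bnd (S : Finset Z3) : Finset Z3 := S.filter fun i => ∃ d, IsNbr d ∧ i + d ∉ S

theorem mem_bnd {S : Finset Z3} {i : Z3} : i ∈ bnd S ↔ i ∈ S ∧ ∃ d, IsNbr d ∧ i + d ∉ S := by
  simp only [bnd, Finset.mem_filter]

theorem norm_sum_filter_le {E : Type*} [NormedAddCommGroup E] (S : Finset Z3) {F : Z3 → E} {M : ℝ}
    (hF : ∀ i, ‖F i‖ ≤ M) {d : Z3} (hd : IsNbr d) :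
    ‖∑ i ∈ S.filter (fun i => ¬ (i + d ∈ S)), F i‖ ≤ M * (bnd S).card := by
  have hM : 0 ≤ M := (norm_nonneg _).trans (hF 0)
  refine (norm_sum_le_of_le _ fun i _ => hF i).trans ?_
  rw [Finset.sum_const, nsmul_eq_mul, mul_comm]
  refine mul_le_mul_of_nonneg_left ?_ hM
  refine Nat.cast_le.2 (Finset.card_le_card fun i hi => ?_)
  rw [Finset.mem_filter] at hi
  exact mem_bnd.2 ⟨hi.1, d, hd, hi.2⟩

theorem norm_sum_sub_sum_filter_le {E : Type*} [NormedAddCommGroup E] (S : Finset Z3) {F : Z3 → E}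
    {M : ℝ} (hF : ∀ i, ‖F i‖ ≤ M) {d : Z3} (hd : IsNbr d) :
    ‖∑ i ∈ S, F i - ∑ i ∈ S.filter (fun i => i + d ∈ S), F i‖ ≤ M * (bnd S).card := by
  rw [← Finset.sum_filter_add_sum_filter_not S (fun i => i + d ∈ S) F, add_sub_cancel_left]
  exact norm_sum_filter_le S hF hd

/-- Shifting a bounded summand by a neighbour vector changes the sum over `S` by a boundary term. -/
theorem norm_sum_shift_sub_le {E : Type*} [NormedAddCommGroup E] (S : Finset Z3) {F : Z3 → E}
    {M : ℝ} (hF : ∀ i, ‖F i‖ ≤ M) {s : Z3} (hs : IsNbr s) :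
    ‖∑ i ∈ S, F (i + s) - ∑ i ∈ S, F i‖ ≤ 2 * (M * (bnd S).card) := by
  have h1 := norm_sum_sub_sum_filter_le S (fun i => hF (i + s)) hs
  have h2 := norm_sum_sub_sum_filter_le S hF hs.neg
  have h3 : ∑ i ∈ S.filter (fun i => i + s ∈ S), F (i + s) =
      ∑ i ∈ S.filter (fun i => i + -s ∈ S), F i := by
    refine Finset.sum_bij' (fun i _ => i + s) (fun i _ => i + -s) ?_ ?_ ?_ ?_ ?_ <;>
      simp +contextual
  rw [h3] at h1
  rw [norm_sub_rev] at h2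
  rw [two_mul]
  refine le_trans ?_ (add_le_add h1 h2)
  refine le_trans (le_of_eq ?_) (norm_add_le _ _)
  rw [sub_add_sub_cancel]

/-- The sum of `f` over the ordered pairs `(i, i + d)` with `i ∈ S`. -/
def dirSum (f : S2 → S2 → ℝ) (u : Z3 → S2) (S : Finset Z3) (d : Z3) : ℝ :=
  ∑ i ∈ S, f (u i) (u (i + d))

theorem abs_dirSum_neg_sub_le (hf : ∀ u v, |f u v| ≤ C) (hsymm : ∀ u v, f u v = f v u)
    (u : Z3 → S2) (S : Finset Z3) {d : Z3} (hd : IsNbr d) :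
    |dirSum f u S (-d) - dirSum f u S d| ≤ 2 * (C * (bnd S).card) := by
  have h := norm_sum_shift_sub_le S (F := fun i => f (u i) (u (i + d))) (M := C)
    (fun i => hf _ _) hd.neg
  rw [Real.norm_eq_abs] at h
  have e : dirSum f u S (-d) = ∑ i ∈ S, f (u (i + -d)) (u (i + -d + d)) :=
    Finset.sum_congr rfl fun i _ => by rw [hsymm, neg_add_cancel_right]
  rw [e]
  exact h

theorem abs_sum_pair_sub_dirSum_le (hf : ∀ u v, |f u v| ≤ C) (u : Z3 → S2) (S : Finset Z3)
    {s : Z3} (hs : IsNbr s) (t d : Z3) (htd : s + d = t) :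
    |∑ i ∈ S, f (u (i + s)) (u (i + t)) - dirSum f u S d| ≤ 2 * (C * (bnd S).card) := by
  have h := norm_sum_shift_sub_le S (F := fun i => f (u i) (u (i + d))) (M := C)
    (fun i => hf _ _) hs
  rw [Real.norm_eq_abs] at h
  simp only [add_assoc, htd] at h
  exact h

/-- The corners `i`, `i + a`, `i + b`, `i + a + b` of a lattice square, with their spins. -/
def corners (u : Z3 → S2) (a b i : Z3) : Fin 4 → S2 :=
  ![u i, u (i + a), u (i + b), u (i + (a + b))]

theorem abs_sum_corners_sub_le (hf : ∀ u v, |f u v| ≤ C) (u : Z3 → S2) (S : Finset Z3) {a b : Z3}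
    (ha : IsNbr a) (hb : IsNbr b) :
    |∑ i ∈ S, pairSum f (corners u a b i) -
      (2 * dirSum f u S a + 2 * dirSum f u S b + dirSum f u S (a + b) + dirSum f u S (b - a))|
      ≤ 12 * (C * (bnd S).card) := by
  have h0 : IsNbr 0 := fun k => by simp
  have e (s t : Z3) (hs : IsNbr s) := abs_le.1 (abs_sum_pair_sub_dirSum_le hf u S hs t (t - s)
    (by abel))
  have h1 := e 0 a h0
  have h2 := e 0 b h0
  have h3 := e 0 (a + b) h0
  have h4 := e a b ha
  have h5 := e a (a + b) ha
  have h6 := e b (a + b) hb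
  simp only [sub_zero, add_sub_cancel_left, add_sub_cancel_right, add_zero] at h1 h2 h3 h4 h5 h6
  have hs : ∑ i ∈ S, pairSum f (corners u a b i) =
      ∑ i ∈ S, f (u i) (u (i + a)) + ∑ i ∈ S, f (u i) (u (i + b)) +
      ∑ i ∈ S, f (u i) (u (i + (a + b))) + ∑ i ∈ S, f (u (i + a)) (u (i + b)) +
      ∑ i ∈ S, f (u (i + a)) (u (i + (a + b))) + ∑ i ∈ S, f (u (i + b)) (u (i + (a + b))) := by
    simp only [← Finset.sum_add_distrib]
    exact Finset.sum_congr rfl fun i _ => pairSum_eq f _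
  rw [hs, abs_le]
  constructor <;> linarith

/-- The edge vectors of the squares of the three orientations. -/
def edges : Fin 3 → Z3 × Z3 :=
  ![(![1, 0, 0], ![0, 1, 0]), (![0, 1, 0], ![0, 0, 1]), (![0, 0, 1], ![1, 0, 0])]

theorem isNbr_edges (k : Fin 3) : IsNbr (edges k).1 ∧ IsNbr (edges k).2 ∧
    IsNbr ((edges k).1 + (edges k).2) := by
  unfold IsNbr edges
  fin_cases k <;> decide

/-- The spins at the corners of the square of orientation `k` at `i`. -/
def square (u : Z3 → S2) (i : Z3) (k : Fin 3) : Fin 4 → S2 :=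
  corners u (edges k).1 (edges k).2 i

/-- The energy attributed to the site `i`: half the sum of the energies of the three squares
based at `i`. -/
def siteEnergy (f : S2 → S2 → ℝ) (u : Z3 → S2) (i : Z3) : ℝ :=
  (1 / 2) * ∑ k, pairSum f (square u i k)

theorem abs_siteEnergy_le (hf : ∀ u v, |f u v| ≤ C) (u : Z3 → S2) (i : Z3) :
    |siteEnergy f u i| ≤ 9 * C := by
  have h (k : Fin 3) := abs_le.1 (abs_pairSum_le hf (square u i k))
  have h0 := h 0
  have h1 := h 1
  have h2 := h 2
  rw [siteEnergy, Fin.sum_univ_three, abs_le]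
  constructor <;> linarith

/-- Integer vectors of squared length `m`, for `m ≤ 3`. -/
def offsets (m : ℤ) : Finset Z3 :=
  (Fintype.piFinset fun _ => Finset.Icc (-1) 1).filter fun d => ∑ k, d k ^ 2 = m

theorem offsets_one : offsets 1 =
    {![1, 0, 0], -![1, 0, 0], ![0, 1, 0], -![0, 1, 0], ![0, 0, 1], -![0, 0, 1]} := by
  decide +kernel

theorem offsets_two : offsets 2 =
    {![1, 1, 0], -![1, 1, 0], ![0, 1, 1], -![0, 1, 1], ![1, 0, 1], -![1, 0, 1],
     ![-1, 1, 0], -![-1, 1, 0], ![0, -1, 1], -![0, -1, 1], ![1, 0, -1], -![1, 0, -1]} := by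
  decide +kernel

theorem mem_offsets {m : ℤ} (hm : m ≤ 3) {d : Z3} : d ∈ offsets m ↔ ∑ k, d k ^ 2 = m := by
  rw [offsets, Finset.mem_filter, and_iff_right_iff_imp]
  intro h
  rw [Fintype.mem_piFinset]
  intro k
  have hk : d k ^ 2 ≤ ∑ k, d k ^ 2 :=
    Finset.single_le_sum (f := fun k => d k ^ 2) (fun _ _ => sq_nonneg _) (Finset.mem_univ k)
  rw [Finset.mem_Icc]
  constructor <;> nlinarith

theorem finsum_bonds {m : ℤ} (hm : m ≤ 3) (S : Finset Z3) (F : Z3 × Z3 → ℝ) :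
    ∑ᶠ p ∈ bonds m (S : Set Z3), F p =
      ∑ d ∈ offsets m, ∑ i ∈ S.filter (fun i => i + d ∈ S), F (i, i + d) := by
  have hset : bonds m (S : Set Z3) =
      ↑((S ×ˢ S).filter fun p : Z3 × Z3 => ∑ k, (p.1 k - p.2 k) ^ 2 = m) := by
    ext p
    simp [bonds, and_assoc]
  rw [hset, finsum_mem_coe_finset, Finset.sum_sigma']
  refine Finset.sum_bij' (fun p _ => ⟨p.2 - p.1, p.1⟩) (fun x _ => (x.2, x.2 + x.1)) ?_ ?_ ?_ ?_ ?_
  · intro p hp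
    simp only [Finset.mem_filter, Finset.mem_product] at hp
    simp only [Finset.mem_sigma, Finset.mem_filter, mem_offsets hm, add_sub_cancel]
    refine ⟨?_, hp.1⟩
    rw [← hp.2]
    exact Finset.sum_congr rfl fun k _ => by simp only [Pi.sub_apply]; ring
  · intro x hx
    simp only [Finset.mem_sigma, Finset.mem_filter, mem_offsets hm] at hx
    simp only [Finset.mem_filter, Finset.mem_product]
    refine ⟨hx.2, ?_⟩
    rw [← hx.1]
    exact Finset.sum_congr rfl fun k _ => by simp only [Pi.add_apply]; ring
  · intro p _
    simp
  · intro x _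
    simp
  · intro p _
    simp

/-- Up to a boundary term, the lattice energy is the sum of the energies of the sites. -/
theorem abs_latticeEnergy_sub_le (hf : ∀ u v, |f u v| ≤ C) (hsymm : ∀ u v, f u v = f v u)
    (S : Finset Z3) (u : Z3 → S2) :
    |latticeEnergy f S u - ∑ i ∈ S, siteEnergy f u i| ≤ 36 * (C * (bnd S).card) := by
  set B : ℝ := C * (bnd S).card
  let R (d : Z3) : ℝ := ∑ i ∈ S.filter (fun i => i + d ∈ S), f (u i) (u (i + d))
  have hR (d : Z3) (hd : IsNbr d) : dirSum f u S d - B ≤ R d ∧ R d ≤ dirSum f u S d + B := by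
    have := abs_le.1 (norm_sum_sub_sum_filter_le S (F := fun i => f (u i) (u (i + d)))
      (fun i => hf _ _) hd)
    constructor
    · simp only [dirSum, R, B]; linarith
    · simp only [dirSum, R, B]; linarith
  have hpm (d : Z3) (hd : IsNbr d) : 2 * dirSum f u S d - 4 * B ≤ R d + R (-d) ∧
      R d + R (-d) ≤ 2 * dirSum f u S d + 4 * B := by
    have h1 := hR d hd
    have h2 := hR (-d) hd.neg
    have h3 := abs_le.1 (abs_dirSum_neg_sub_le hf hsymm u S hd)
    constructor <;> linarith
  have hE1 : ∑ᶠ p ∈ bonds 1 (S : Set Z3), f (u p.1) (u p.2) =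
      (R ![1, 0, 0] + R (-![1, 0, 0])) + (R ![0, 1, 0] + R (-![0, 1, 0])) +
      (R ![0, 0, 1] + R (-![0, 0, 1])) := by
    rw [finsum_bonds (by norm_num) S (fun p => f (u p.1) (u p.2)), offsets_one]
    repeat rw [Finset.sum_insert (by decide)]
    rw [Finset.sum_singleton]
    ring
  have hE2 : ∑ᶠ p ∈ bonds 2 (S : Set Z3), f (u p.1) (u p.2) =
      (R ![1, 1, 0] + R (-![1, 1, 0])) + (R ![0, 1, 1] + R (-![0, 1, 1])) +
      (R ![1, 0, 1] + R (-![1, 0, 1])) + (R ![-1, 1, 0] + R (-![-1, 1, 0])) +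
      (R ![0, -1, 1] + R (-![0, -1, 1])) + (R ![1, 0, -1] + R (-![1, 0, -1])) := by
    rw [finsum_bonds (by norm_num) S (fun p => f (u p.1) (u p.2)), offsets_two]
    repeat rw [Finset.sum_insert (by decide)]
    rw [Finset.sum_singleton]
    ring
  have hsite : ∑ i ∈ S, siteEnergy f u i =
      (1 / 2) * (∑ i ∈ S, pairSum f (corners u ![1, 0, 0] ![0, 1, 0] i) +
        ∑ i ∈ S, pairSum f (corners u ![0, 1, 0] ![0, 0, 1] i) +
        ∑ i ∈ S, pairSum f (corners u ![0, 0, 1] ![1, 0, 0] i)) := by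
    simp only [← Finset.sum_add_distrib, Finset.mul_sum]
    refine Finset.sum_congr rfl fun i _ => ?_
    rw [siteEnergy, Fin.sum_univ_three]
    rfl
  have n1 : IsNbr ![1, 0, 0] := by unfold IsNbr; decide
  have n2 : IsNbr ![0, 1, 0] := by unfold IsNbr; decide
  have n3 : IsNbr ![0, 0, 1] := by unfold IsNbr; decide
  have s1 := abs_le.1 (abs_sum_corners_sub_le hf u S n1 n2)
  have s2 := abs_le.1 (abs_sum_corners_sub_le hf u S n2 n3)
  have s3 := abs_le.1 (abs_sum_corners_sub_le hf u S n3 n1)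
  have e1 : (![1, 0, 0] : Z3) + ![0, 1, 0] = ![1, 1, 0] := by decide
  have e2 : (![0, 1, 0] : Z3) + ![0, 0, 1] = ![0, 1, 1] := by decide
  have e3 : (![0, 0, 1] : Z3) + ![1, 0, 0] = ![1, 0, 1] := by decide
  have e4 : (![0, 1, 0] : Z3) - ![1, 0, 0] = ![-1, 1, 0] := by decide
  have e5 : (![0, 0, 1] : Z3) - ![0, 1, 0] = ![0, -1, 1] := by decide
  have e6 : (![1, 0, 0] : Z3) - ![0, 0, 1] = ![1, 0, -1] := by decide
  rw [e1, e4] at s1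
  rw [e2, e5] at s2
  rw [e3, e6] at s3
  have p1 := hpm _ n1
  have p2 := hpm _ n2
  have p3 := hpm _ n3
  have p4 := hpm ![1, 1, 0] (by unfold IsNbr; decide)
  have p5 := hpm ![0, 1, 1] (by unfold IsNbr; decide)
  have p6 := hpm ![1, 0, 1] (by unfold IsNbr; decide)
  have p7 := hpm ![-1, 1, 0] (by unfold IsNbr; decide)
  have p8 := hpm ![0, -1, 1] (by unfold IsNbr; decide)
  have p9 := hpm ![1, 0, -1] (by unfold IsNbr; decide)
  rw [latticeEnergy, hE1, hE2, hsite, abs_le]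
  constructor <;> linarith

/-! ### Jordan measurable sets -/

/-- A bounded set whose boundary is negligible. -/
structure JordanMeasurable (A : Set E3) : Prop where
  bounded : Bornology.IsBounded A
  null_frontier : volume (frontier A) = 0

/-- The volume of the closed `r`-neighbourhood of the boundary of `A`. -/
def layer (A : Set E3) (r : ℝ) : ℝ := volume.real (Metric.cthickening r (frontier A))

namespace JordanMeasurable

variable {B : Set E3}

theorem nullMeasurableSet (hA : JordanMeasurable A) : NullMeasurableSet A volume :=
  nullMeasurableSet_of_null_frontier hA.null_frontier

theorem volume_lt_top (hA : JordanMeasurable A) : volume A < ⊤ := hA.bounded.measure_lt_top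

theorem inter (hA : JordanMeasurable A) (hB : volume (frontier B) = 0) :
    JordanMeasurable (A ∩ B) := by
  refine ⟨hA.bounded.subset Set.inter_subset_left, ?_⟩
  refine measure_mono_null ((frontier_inter_subset A B).trans ?_)
    (measure_union_null hA.null_frontier hB)
  exact Set.union_subset_union Set.inter_subset_left Set.inter_subset_right

theorem isCompact_frontier (hA : JordanMeasurable A) : IsCompact (frontier A) :=
  Metric.isCompact_of_isClosed_isBounded isClosed_frontier
    (hA.bounded.closure.subset frontier_subset_closure)

theorem isBounded_cthickening (hA : JordanMeasurable A) (r : ℝ) :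
    Bornology.IsBounded (Metric.cthickening r (frontier A)) :=
  hA.isCompact_frontier.isBounded.cthickening

theorem tendsto_layer (hA : JordanMeasurable A) (c : ℝ) :
    Tendsto (fun ε => layer A (c * ε)) (𝓝[>] 0) (𝓝 0) := by
  have h := tendsto_measure_cthickening_of_isCompact (μ := volume) hA.isCompact_frontier
  rw [hA.null_frontier] at h
  have h2 : Tendsto (fun ε : ℝ => c * ε) (𝓝[>] 0) (𝓝 0) := by
    have : Tendsto (fun ε : ℝ => c * ε) (𝓝 0) (𝓝 (c * 0)) := tendsto_id.const_mul c
    rw [mul_zero] at this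
    exact this.mono_left nhdsWithin_le_nhds
  exact (ENNReal.tendsto_toReal ENNReal.zero_ne_top).comp (h.comp h2)

end JordanMeasurable

theorem exists_mem_frontier_dist_le {A : Set E3} {x y : E3} (hx : x ∈ A) (hy : y ∉ A) :
    ∃ z ∈ frontier A, dist x z ≤ dist x y ∧ dist y z ≤ dist x y := by
  have hc : IsPreconnected (segment ℝ x y) := (convex_segment x y).isPreconnected
  obtain ⟨z, hz, hzA⟩ : (segment ℝ x y ∩ frontier A).Nonempty := by
    by_contra! hempty
    have hno (w : E3) (hw : w ∈ segment ℝ x y) : w ∉ frontier A := fun hwA =>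
      (hempty ▸ (⟨hw, hwA⟩ : w ∈ segment ℝ x y ∩ frontier A) : w ∈ (∅ : Set E3))
    have hin (w : E3) (hw : w ∈ segment ℝ x y) (hwA : w ∈ A) : w ∈ interior A := by
      by_contra hi
      exact hno w hw ⟨subset_closure hwA, hi⟩
    have hout (w : E3) (hw : w ∈ segment ℝ x y) (hwA : w ∉ A) : w ∈ interior Aᶜ := by
      by_contra hi
      refine hno w hw ?_
      rw [← frontier_compl]
      exact ⟨subset_closure hwA, hi⟩
    obtain ⟨w, -, hw1, hw2⟩ := hc _ _ isOpen_interior isOpen_interior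
      (fun w hw => (em (w ∈ A)).imp (hin w hw) (hout w hw))
      ⟨x, left_mem_segment ℝ x y, hin x (left_mem_segment ℝ x y) hx⟩
      ⟨y, right_mem_segment ℝ x y, hout y (right_mem_segment ℝ x y) hy⟩
    exact interior_subset hw2 (interior_subset hw1)
  refine ⟨z, hzA, ?_, ?_⟩
  · have := dist_add_dist_of_mem_segment hz
    linarith [dist_nonneg (x := z) (y := y)]
  · have := dist_add_dist_of_mem_segment hz
    rw [dist_comm y z]
    linarith [dist_nonneg (x := x) (y := z)]

/-! ### Cells -/

theorem mem_cell {ε : ℝ} {i : Z3} {x : E3} :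
    x ∈ cell ε i ↔ ∀ k, -(ε / 2) ≤ x k - ε * i k ∧ x k - ε * i k < ε / 2 := Iff.rfl

/-- The index of the cell that contains `x`. -/
def cellIndex (ε : ℝ) (x : E3) : Z3 := fun k => ⌊x k / ε + 1 / 2⌋

theorem mem_cell_iff {ε : ℝ} (hε : 0 < ε) {i : Z3} {x : E3} :
    x ∈ cell ε i ↔ cellIndex ε x = i := by
  rw [mem_cell, funext_iff]
  refine forall_congr' fun k => ?_
  rw [cellIndex, Int.floor_eq_iff]
  have h : x k = x k / ε * ε := (div_mul_cancel₀ _ hε.ne').symm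
  set y := x k / ε
  rw [h]
  constructor
  · rintro ⟨h1, h2⟩
    constructor
    · by_contra hlt
      nlinarith
    · by_contra hlt
      nlinarith
  · rintro ⟨h1, h2⟩
    constructor <;> nlinarith

theorem dist_le_of_abs_le {x y : E3} {r : ℝ} (hr : 0 ≤ r) (h : ∀ k, |x k - y k| ≤ r / 2) :
    dist x y ≤ r := by
  rw [EuclideanSpace.dist_eq, Real.sqrt_le_left hr, Fin.sum_univ_three]
  have h' (k : Fin 3) : dist (x k) (y k) ^ 2 ≤ (r / 2) ^ 2 := by
    rw [Real.dist_eq]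
    exact pow_le_pow_left₀ (abs_nonneg _) (h k) 2
  nlinarith [h' 0, h' 1, h' 2, sq_nonneg r]

theorem dist_latticePoint_le {ε : ℝ} (hε : 0 < ε) {i : Z3} {x : E3} (hx : x ∈ cell ε i) :
    dist x (latticePoint ε i) ≤ ε :=
  dist_le_of_abs_le hε.le fun k => abs_le.2 ⟨(mem_cell.1 hx k).1, (mem_cell.1 hx k).2.le⟩

theorem dist_latticePoint_add_le {ε : ℝ} (hε : 0 < ε) (i : Z3) {d : Z3} (hd : IsNbr d) :
    dist (latticePoint ε i) (latticePoint ε (i + d)) ≤ 2 * ε := by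
  refine dist_le_of_abs_le (by positivity) fun k => ?_
  have h : latticePoint ε i k - latticePoint ε (i + d) k = -(ε * d k) := by
    simp [latticePoint]; ring
  rw [h, abs_neg, abs_mul, abs_of_pos hε]
  have : |(d k : ℝ)| ≤ 1 := by exact_mod_cast hd k
  nlinarith

theorem measurableSet_cube (h : ℝ) : MeasurableSet (cube h) := by
  have : cube h = ⋂ k, {x | -(h / 2) ≤ x k ∧ x k < h / 2} := by ext; simp [cube]
  rw [this]
  refine MeasurableSet.iInter fun k => ?_
  have hk : Measurable fun x : E3 => x k := by fun_prop
  exact (measurableSet_le measurable_const hk).inter (measurableSet_lt hk measurable_const)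

theorem volume_cube {h : ℝ} (hh : 0 ≤ h) : volume (cube h) = ENNReal.ofReal (h ^ 3) := by
  have h1 : cube h = (MeasurableEquiv.toLp 2 (Fin 3 → ℝ)).symm ⁻¹'
      (Set.univ.pi fun _ => Set.Ico (-(h / 2)) (h / 2)) := by
    ext x; simp [cube]
  rw [h1, (EuclideanSpace.volume_preserving_symm_measurableEquiv_toLp (Fin 3)).measure_preimage
    (MeasurableSet.univ_pi fun _ => measurableSet_Ico).nullMeasurableSet, Real.volume_pi_Ico]
  simp only [Finset.prod_const, Finset.card_univ, Fintype.card_fin]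
  rw [← ENNReal.ofReal_pow (by linarith)]
  ring_nf

theorem cell_eq_preimage (ε : ℝ) (i : Z3) : cell ε i = (fun x => x - latticePoint ε i) ⁻¹' cube ε :=
  rfl

theorem measurableSet_cell (ε : ℝ) (i : Z3) : MeasurableSet (cell ε i) :=
  (measurableSet_cube ε).preimage (by fun_prop)

theorem volume_cell {ε : ℝ} (hε : 0 ≤ ε) (i : Z3) :
    volume (cell ε i) = ENNReal.ofReal (ε ^ 3) := by
  rw [cell_eq_preimage, ← volume_cube hε]
  simp only [sub_eq_add_neg]
  exact measure_preimage_add_right _ _ _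

theorem volume_real_cell {ε : ℝ} (hε : 0 ≤ ε) (i : Z3) : volume.real (cell ε i) = ε ^ 3 := by
  rw [Measure.real, volume_cell hε, ENNReal.toReal_ofReal (by positivity)]

theorem convex_cube (h : ℝ) : Convex ℝ (cube h) := by
  have : cube h = ⋂ k, (EuclideanSpace.proj (𝕜 := ℝ) k : E3 →L[ℝ] ℝ) ⁻¹'
      Set.Ico (-(h / 2)) (h / 2) := by
    ext; simp [cube]
  rw [this]
  exact convex_iInter fun k => (convex_Ico _ _).is_linear_preimage
    (EuclideanSpace.proj (𝕜 := ℝ) k : E3 →L[ℝ] ℝ).isLinear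

theorem null_frontier_cell (ε : ℝ) (i : Z3) : volume (frontier (cell ε i)) = 0 := by
  refine Convex.addHaar_frontier volume ?_
  rw [cell_eq_preimage]
  simp only [sub_eq_add_neg]
  exact (convex_cube ε).translate_preimage_left _

theorem pairwise_disjoint_cell {ε : ℝ} (hε : 0 < ε) : Pairwise (Function.onFun Disjoint (cell ε)) :=
  fun _ _ hij => Set.disjoint_left.2 fun _ hi hj =>
    hij (((mem_cell_iff hε).1 hi).symm.trans ((mem_cell_iff hε).1 hj))

theorem jordanMeasurable_cube {h : ℝ} (hh : 0 < h) : JordanMeasurable (cube h) := by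
  refine ⟨?_, Convex.addHaar_frontier volume (convex_cube h)⟩
  refine (Metric.isBounded_closedBall (x := (0 : E3)) (r := h)).subset fun x hx => ?_
  exact dist_le_of_abs_le hh.le fun k => by
    simpa using abs_le.2 ⟨(hx k).1, (hx k).2.le⟩

/-! ### Lattice points of a bounded set -/

theorem finite_latticeIn {ε : ℝ} (hε : 0 < ε) {A : Set E3} (hA : Bornology.IsBounded A) :
    (latticeIn ε A).Finite := by
  obtain ⟨R, hR⟩ := hA.subset_closedBall 0
  obtain ⟨N, hN⟩ := exists_nat_gt (R / ε)
  refine (Set.finite_Icc (fun _ => -(N : ℤ) : Z3) (fun _ => (N : ℤ))).subset fun i hi => ?_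
  have h1 (k : Fin 3) : |i k| ≤ (N : ℤ) := by
    have h2 : ‖latticePoint ε i‖ ≤ R := by simpa using hR hi
    have h3 := (PiLp.norm_apply_le (latticePoint ε i) k).trans h2
    have h4 : latticePoint ε i k = ε * i k := rfl
    rw [h4, Real.norm_eq_abs, abs_mul, abs_of_pos hε] at h3
    rw [div_lt_iff₀ hε] at hN
    have : (|i k| : ℝ) ≤ N := by nlinarith
    exact_mod_cast this
  exact ⟨fun k => (abs_le.1 (h1 k)).1, fun k => (abs_le.1 (h1 k)).2⟩

open Classical in
/-- The lattice points of `A`, as a finite set; the empty set if there are infinitely many. -/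
def latticeFinset (ε : ℝ) (A : Set E3) : Finset Z3 :=
  if h : (latticeIn ε A).Finite then h.toFinset else ∅

theorem coe_latticeFinset {ε : ℝ} (hε : 0 < ε) {A : Set E3} (hA : Bornology.IsBounded A) :
    (latticeFinset ε A : Set Z3) = latticeIn ε A := by
  rw [latticeFinset, dif_pos (finite_latticeIn hε hA), Set.Finite.coe_toFinset]

theorem mem_latticeFinset {ε : ℝ} (hε : 0 < ε) {A : Set E3} (hA : Bornology.IsBounded A) {i : Z3} :
    i ∈ latticeFinset ε A ↔ latticePoint ε i ∈ A := by
  rw [← Finset.mem_coe, coe_latticeFinset hε hA]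
  rfl

/-- The union of the cells around the lattice points of `A`. -/
def cellUnion (ε : ℝ) (A : Set E3) : Set E3 := ⋃ i ∈ latticeFinset ε A, cell ε i

theorem measurableSet_cellUnion (ε : ℝ) (A : Set E3) : MeasurableSet (cellUnion ε A) :=
  Finset.measurableSet_biUnion _ fun i _ => measurableSet_cell ε i

theorem mem_cellUnion {ε : ℝ} (hε : 0 < ε) {A : Set E3} (hA : Bornology.IsBounded A) {x : E3} :
    x ∈ cellUnion ε A ↔ latticePoint ε (cellIndex ε x) ∈ A := by
  simp only [cellUnion, Set.mem_iUnion, mem_latticeFinset hε hA, mem_cell_iff hε]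
  constructor
  · rintro ⟨i, hi, rfl⟩
    exact hi
  · exact fun h => ⟨_, h, rfl⟩

section Boundary

variable {ε : ℝ}

theorem diff_cellUnion_subset (hε : 0 < ε) (hA : Bornology.IsBounded A) :
    A \ cellUnion ε A ⊆ Metric.cthickening (1 * ε) (frontier A) := by
  rintro x ⟨hx, hx'⟩
  rw [mem_cellUnion hε hA] at hx'
  obtain ⟨z, hz, hd, _⟩ := exists_mem_frontier_dist_le hx hx'
  rw [one_mul]
  exact Metric.mem_cthickening_of_dist_le x z _ _ hz
    (hd.trans (dist_latticePoint_le hε ((mem_cell_iff hε).2 rfl)))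

theorem cellUnion_diff_subset (hε : 0 < ε) (hA : Bornology.IsBounded A) :
    cellUnion ε A \ A ⊆ Metric.cthickening (1 * ε) (frontier A) := by
  rintro x ⟨hx', hx⟩
  rw [mem_cellUnion hε hA] at hx'
  obtain ⟨z, hz, _, hd⟩ := exists_mem_frontier_dist_le hx' hx
  rw [one_mul]
  rw [dist_comm (latticePoint _ _)] at hd
  exact Metric.mem_cthickening_of_dist_le x z _ _ hz
    (hd.trans (dist_latticePoint_le hε ((mem_cell_iff hε).2 rfl)))

/-- The integral over `A` of a function that is constant on the cells is, up to a boundary term,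
the sum of its values at the lattice points of `A`, times the volume of a cell. -/
theorem norm_setIntegral_sub_le {E : Type*} [NormedAddCommGroup E] [NormedSpace ℝ E]
    [CompleteSpace E]
    (hε : 0 < ε) (hA : JordanMeasurable A) {q : E3 → E} {t : Z3 → E} {M : ℝ}
    (hq : IntegrableOn q A volume) (hqM : ∀ᵐ x ∂volume.restrict A, ‖q x‖ ≤ M)
    (ht : ∀ i, ‖t i‖ ≤ M)
    (hqt : ∀ i ∈ latticeIn ε A, ∀ᵐ x ∂volume.restrict A, x ∈ cell ε i → q x = t i) :
    ‖(∫ x in A, q x) - ε ^ 3 • ∑ i ∈ latticeFinset ε A, t i‖ ≤ 2 * (M * layer A (1 * ε)) := by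
  have hM : 0 ≤ M := (norm_nonneg _).trans (ht 0)
  set V := cellUnion ε A
  let T (x : E3) : E := t (cellIndex ε x)
  have hTcell (i : Z3) : ∫ x in cell ε i, T x = ε ^ 3 • t i := by
    rw [setIntegral_congr_fun (measurableSet_cell ε i)
      (g := fun _ => t i) fun x hx => by simp only [T, (mem_cell_iff hε).1 hx],
      setIntegral_const, volume_real_cell hε.le]
  have hTint (i : Z3) : IntegrableOn T (cell ε i) volume := by
    refine (integrableOn_const (C := t i) ?_).congr_fun
      (fun x hx => by simp only [T, (mem_cell_iff hε).1 hx]) (measurableSet_cell ε i)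
    rw [volume_cell hε.le]
    exact ENNReal.ofReal_ne_top
  have hsum : ε ^ 3 • ∑ i ∈ latticeFinset ε A, t i = ∫ x in V, T x := by
    rw [Finset.smul_sum]
    change _ = ∫ x in ⋃ i ∈ latticeFinset ε A, cell ε i, T x
    rw [integral_biUnion_finset _ (fun i _ => measurableSet_cell ε i)
      (fun i _ j _ hij => pairwise_disjoint_cell hε hij) (fun i _ => hTint i)]
    exact Finset.sum_congr rfl fun i _ => (hTcell i).symm
  have hTV : IntegrableOn T V volume :=
    (integrableOn_finset_iUnion (s := latticeFinset ε A)).2 fun i _ => hTint i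
  have hV := measurableSet_cellUnion ε A
  rw [hsum, ← integral_inter_add_sdiff hV hq, ← integral_inter_add_sdiff₀ hA.nullMeasurableSet hTV,
    Set.inter_comm V A]
  -- The two integrands agree on `A ∩ V`; the differences of `A` and `V` lie near the boundary.
  have heq : ∫ x in A ∩ V, q x = ∫ x in A ∩ V, T x := by
    refine integral_congr_ae ?_
    have h1 : ∀ᵐ x ∂volume.restrict A, ∀ i ∈ latticeFinset ε A, x ∈ cell ε i → q x = t i := by
      rw [Finset.eventually_all]
      exact fun i hi => hqt i ((mem_latticeFinset hε hA.bounded).1 hi)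
    have h2 := ae_restrict_of_ae_restrict_of_subset (Set.inter_subset_left : A ∩ V ⊆ A) h1
    have h3 : ∀ᵐ x ∂volume.restrict (A ∩ V), x ∈ V :=
      ae_restrict_of_ae_restrict_of_subset (Set.inter_subset_right : A ∩ V ⊆ V)
        (ae_restrict_mem hV)
    filter_upwards [h2, h3] with x hx hxV
    rw [mem_cellUnion hε hA.bounded] at hxV
    exact hx _ ((mem_latticeFinset hε hA.bounded).2 hxV) ((mem_cell_iff hε).2 rfl)
  rw [heq, add_sub_add_left_eq_sub, two_mul]
  have hfin : volume (Metric.cthickening (1 * ε) (frontier A)) ≠ ⊤ :=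
    (hA.isBounded_cthickening _).measure_lt_top.ne
  have hb1 : ‖∫ x in A \ V, q x‖ ≤ M * layer A (1 * ε) := by
    refine (norm_setIntegral_le_of_norm_le_const_ae
      ((measure_mono Set.sdiff_subset).trans_lt hA.volume_lt_top)
      (ae_restrict_of_ae_restrict_of_subset Set.sdiff_subset hqM)).trans ?_
    exact mul_le_mul_of_nonneg_left
      (measureReal_mono (diff_cellUnion_subset hε hA.bounded) hfin) hM
  have hb2 : ‖∫ x in V \ A, T x‖ ≤ M * layer A (1 * ε) := by
    have hsub := cellUnion_diff_subset hε hA.bounded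
    refine (norm_setIntegral_le_of_norm_le_const
      ((measure_mono hsub).trans_lt hfin.lt_top) fun x _ => ht _).trans ?_
    exact mul_le_mul_of_nonneg_left (measureReal_mono hsub hfin) hM
  exact (norm_sub_le _ _).trans (add_le_add hb1 hb2)

theorem abs_card_sub_volume_le (hε : 0 < ε) (hA : JordanMeasurable A) :
    |ε ^ 3 * (latticeFinset ε A).card - volume.real A| ≤ 2 * layer A (1 * ε) := by
  have h := norm_setIntegral_sub_le (E := ℝ) hε hA (q := fun _ => 1) (t := fun _ => 1) (M := 1)
    (integrableOn_const hA.volume_lt_top.ne) (Eventually.of_forall fun _ => by simp)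
    (fun _ => by simp) (fun _ _ => Eventually.of_forall fun _ _ => rfl)
  rw [setIntegral_const, norm_sub_rev] at h
  simpa using h

theorem card_bnd_le (hε : 0 < ε) (hA : JordanMeasurable A) :
    ε ^ 3 * (bnd (latticeFinset ε A)).card ≤ layer A (3 * ε) := by
  have h1 : volume.real (⋃ i ∈ bnd (latticeFinset ε A), cell ε i) =
      ε ^ 3 * (bnd (latticeFinset ε A)).card := by
    rw [measureReal_biUnion_finset (fun i _ j _ hij => pairwise_disjoint_cell hε hij)
      (fun i _ => measurableSet_cell ε i)
      (fun i _ => by rw [volume_cell hε.le]; exact ENNReal.ofReal_ne_top)]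
    simp only [volume_real_cell hε.le, Finset.sum_const, nsmul_eq_mul, mul_comm]
  rw [← h1]
  refine measureReal_mono ?_ (hA.isBounded_cthickening _).measure_lt_top.ne
  refine Set.iUnion₂_subset fun i hi x hx => ?_
  obtain ⟨hi, d, hd, hid⟩ := mem_bnd.1 hi
  rw [mem_latticeFinset hε hA.bounded] at hi hid
  obtain ⟨z, hz, hz', _⟩ := exists_mem_frontier_dist_le hi hid
  refine Metric.mem_cthickening_of_dist_le x z _ _ hz ?_
  have h2 := dist_triangle x (latticePoint ε i) z
  have h3 := dist_latticePoint_le hε hx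
  have h4 := dist_latticePoint_add_le hε i hd
  linarith

theorem tendsto_card (hA : JordanMeasurable A) :
    Tendsto (fun ε : ℝ => ε ^ 3 * (latticeFinset ε A).card) (𝓝[>] 0) (𝓝 (volume.real A)) := by
  rw [tendsto_iff_norm_sub_tendsto_zero]
  refine squeeze_zero' (Eventually.of_forall fun _ => norm_nonneg _) ?_
    (by simpa using (hA.tendsto_layer 1).const_mul 2)
  filter_upwards [self_mem_nhdsWithin] with ε hε
  simpa using abs_card_sub_volume_le hε hA

theorem tendsto_card_bnd (hA : JordanMeasurable A) :
    Tendsto (fun ε : ℝ => ε ^ 3 * (bnd (latticeFinset ε A)).card) (𝓝[>] 0) (𝓝 0) := by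
  refine squeeze_zero' ?_ ?_ (hA.tendsto_layer 3)
  · filter_upwards [self_mem_nhdsWithin] with ε hε
    have : (0 : ℝ) < ε := hε
    positivity
  · filter_upwards [self_mem_nhdsWithin] with ε hε using card_bnd_le hε hA

end Boundary

/-! ### Lipschitz boundaries are negligible -/

/-- The vertical translates of a graph are disjoint and have equal volumes, so that these
volumes vanish. -/
theorem volume_graph_eq_zero {γ : ℝ × ℝ → ℝ} (hγ : Continuous γ) :
    volume {w : E3 | w 2 = γ (w 0, w 1)} = 0 := by
  let G (t : ℝ) : Set E3 := {w | w 2 = γ (w 0, w 1) + t}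
  have hmeas (t : ℝ) : MeasurableSet (G t) :=
    (isClosed_eq (by fun_prop) (by fun_prop)).measurableSet
  have hdisj : Pairwise (Function.onFun Disjoint G) := fun s t hst =>
    Set.disjoint_left.2 fun w hs ht => hst (add_left_cancel (hs.symm.trans ht))
  have hcount := Measure.countable_meas_pos_of_disjoint_iUnion (μ := volume) hmeas hdisj
  obtain ⟨t, ht⟩ : ∃ t, t ∉ {t | 0 < volume (G t)} := by
    by_contra! h
    exact Cardinal.not_countable_real ((Set.eq_univ_of_forall h) ▸ hcount)
  have ht0 : volume (G t) = 0 := by simpa using ht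
  have htrans : {w : E3 | w 2 = γ (w 0, w 1)} =
      (fun w => w + EuclideanSpace.single 2 t) ⁻¹' G t := by
    ext w
    simp [G]
  rw [htrans, measure_preimage_add_right, ht0]

theorem null_frontier_of_hasLipschitzBoundary {Ω : Set E3} (hopen : IsOpen Ω)
    (h : HasLipschitzBoundary Ω) : volume (frontier Ω) = 0 := by
  refine measure_null_of_locally_null _ fun x hx => ?_
  obtain ⟨r, hr, T, C, γ, hγ, hball⟩ := h x hx
  refine ⟨frontier Ω ∩ Metric.ball x r,
    inter_mem_nhdsWithin _ (Metric.ball_mem_nhds x hr), ?_⟩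
  have hG : MeasurableSet {w : E3 | w 2 = γ (w 0, w 1)} :=
    (isClosed_eq (by fun_prop) (hγ.continuous.comp (by fun_prop))).measurableSet
  have h0 : volume (T ⁻¹' {w : E3 | w 2 = γ (w 0, w 1)}) = 0 := by
    rw [T.measurePreserving.measure_preimage hG.nullMeasurableSet,
      volume_graph_eq_zero hγ.continuous]
  refine measure_mono_null (fun z hz => ?_) h0
  obtain ⟨hzΩ, hz⟩ := hz
  rw [Set.mem_preimage, Set.mem_ofPred_eq]
  have hc1 : Continuous fun y : E3 => γ (T y 0, T y 1) := hγ.continuous.comp (by fun_prop)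
  have hc2 : Continuous fun y : E3 => T y 2 := by fun_prop
  have hzn : z ∉ Ω := by
    rw [hopen.frontier_eq] at hzΩ
    exact hzΩ.2
  refine le_antisymm (not_lt.1 fun hlt => hzn ((hball z hz).2 hlt)) ?_
  -- Below the graph there are no points of `Ω` nearby, so `z` would not be in the closure.
  by_contra! hlt
  have hopen' : IsOpen ({y | T y 2 < γ (T y 0, T y 1)} ∩ Metric.ball x r) :=
    (isOpen_lt hc2 hc1).inter Metric.isOpen_ball
  obtain ⟨y, ⟨hy, hyb⟩, hyΩ⟩ :=
    mem_closure_iff.1 (frontier_subset_closure hzΩ) _ hopen' ⟨hlt, hz⟩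
  exact lt_asymm hy ((hball y hyb).1 hyΩ)

/-! ### Jensen's inequality on the lattice -/

theorem norm_sum_avg4_corners_sub_le (u : Z3 → S2) (S : Finset Z3) {a b : Z3} (ha : IsNbr a)
    (hb : IsNbr b) (hab : IsNbr (a + b)) :
    ‖∑ i ∈ S, avg4 (corners u a b i) - ∑ i ∈ S, tensor (u i)‖ ≤ 2 * (bnd S).card := by
  have h (s : Z3) (hs : IsNbr s) :
      ‖∑ i ∈ S, tensor (u (i + s)) - ∑ i ∈ S, tensor (u i)‖ ≤ 2 * (bnd S).card := by
    have := norm_sum_shift_sub_le S (F := fun i => tensor (u i)) (M := 1)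
      (fun i => (norm_tensor _).le) hs
    rwa [one_mul] at this
  have e : ∑ i ∈ S, avg4 (corners u a b i) - ∑ i ∈ S, tensor (u i) =
      (1 / 4 : ℝ) • ((∑ i ∈ S, tensor (u (i + a)) - ∑ i ∈ S, tensor (u i)) +
        (∑ i ∈ S, tensor (u (i + b)) - ∑ i ∈ S, tensor (u i)) +
        (∑ i ∈ S, tensor (u (i + (a + b))) - ∑ i ∈ S, tensor (u i))) := by
    have e1 : ∑ i ∈ S, avg4 (corners u a b i) = (1 / 4 : ℝ) • (∑ i ∈ S, tensor (u i) +
        ∑ i ∈ S, tensor (u (i + a)) + ∑ i ∈ S, tensor (u (i + b)) +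
        ∑ i ∈ S, tensor (u (i + (a + b)))) := by
      simp only [← Finset.sum_add_distrib, Finset.smul_sum]
      refine Finset.sum_congr rfl fun i _ => ?_
      rw [avg4, Fin.sum_univ_four]
      rfl
    rw [e1]
    module
  rw [e, norm_smul, Real.norm_of_nonneg (by norm_num)]
  have h3 := norm_add₃_le (a := ∑ i ∈ S, tensor (u (i + a)) - ∑ i ∈ S, tensor (u i))
    (b := ∑ i ∈ S, tensor (u (i + b)) - ∑ i ∈ S, tensor (u i))
    (c := ∑ i ∈ S, tensor (u (i + (a + b))) - ∑ i ∈ S, tensor (u i))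
  have := h a ha
  have := h b hb
  have := h _ hab
  have : (0 : ℝ) ≤ (bnd S).card := Nat.cast_nonneg _
  linarith

/-- Jensen's inequality for the squares based at the points of `S`: the energy of the sites is
bounded below by the envelope at a tensor that differs from the mean of `u ⊗ u` over `S` by a
boundary term. -/
theorem exists_env_le_sum_siteEnergy (hf : ∀ u v, |f u v| ≤ C) {S : Finset Z3} (hS : S.Nonempty)
    (u : Z3 → S2) :
    ∃ P ∈ K, ‖P - (S.card : ℝ)⁻¹ • ∑ i ∈ S, tensor (u i)‖ ≤ 2 * ((bnd S).card / S.card) ∧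
      3 / 2 * (S.card * env f P) ≤ ∑ i ∈ S, siteEnergy f u i := by
  have hN : (0 : ℝ) < S.card := Nat.cast_pos.2 hS.card_pos
  set T : Finset (Z3 × Fin 3) := S ×ˢ Finset.univ
  have hw : ∑ _p ∈ T, (1 / (3 * S.card) : ℝ) = 1 := by
    rw [Finset.sum_const, Finset.card_product, Finset.card_univ, Fintype.card_fin, nsmul_eq_mul]
    push_cast
    field_simp
  have hw0 : ∀ p ∈ T, (0 : ℝ) ≤ 1 / (3 * S.card) := fun _ _ => by positivity
  have hK : ∀ p ∈ T, avg4 (square u p.1 p.2) ∈ K := fun p _ => avg4_mem_K _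
  refine ⟨∑ p ∈ T, (1 / (3 * S.card) : ℝ) • avg4 (square u p.1 p.2),
    convex_K.sum_mem hw0 hw hK, ?_, ?_⟩
  · have e : ∑ p ∈ T, (1 / (3 * S.card) : ℝ) • avg4 (square u p.1 p.2) -
        (S.card : ℝ)⁻¹ • ∑ i ∈ S, tensor (u i) = (1 / (3 * S.card) : ℝ) •
        ∑ k, (∑ i ∈ S, avg4 (square u i k) - ∑ i ∈ S, tensor (u i)) := by
      rw [← Finset.smul_sum, Finset.sum_product_right, Finset.sum_sub_distrib, smul_sub,
        Finset.sum_const, Finset.card_univ, Fintype.card_fin, ← Nat.cast_smul_eq_nsmul ℝ,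
        smul_smul]
      congr 2
      push_cast
      field_simp
    rw [e, norm_smul, Real.norm_of_nonneg (by positivity)]
    have h3 : ‖∑ k, (∑ i ∈ S, avg4 (square u i k) - ∑ i ∈ S, tensor (u i))‖ ≤
        ∑ _k : Fin 3, (2 * (bnd S).card : ℝ) :=
      norm_sum_le_of_le _ fun k _ => norm_sum_avg4_corners_sub_le u S (isNbr_edges k).1
        (isNbr_edges k).2.1 (isNbr_edges k).2.2
    rw [Finset.sum_const, Finset.card_univ, Fintype.card_fin, nsmul_eq_mul] at h3
    refine (mul_le_mul_of_nonneg_left h3 (by positivity)).trans (le_of_eq ?_)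
    push_cast
    field_simp
  · have hJ := (convexOn_env hf).map_sum_le hw0 hw hK
    have h1 : ∑ p ∈ T, (1 / (3 * S.card) : ℝ) • env f (avg4 (square u p.1 p.2)) ≤
        ∑ p ∈ T, (1 / (3 * S.card) : ℝ) * pairSum f (square u p.1 p.2) :=
      Finset.sum_le_sum fun p hp => mul_le_mul_of_nonneg_left (env_avg4_le hf _) (hw0 p hp)
    have h2 : ∑ p ∈ T, (1 / (3 * S.card) : ℝ) * pairSum f (square u p.1 p.2) =
        (1 / (3 * S.card)) * (2 * ∑ i ∈ S, siteEnergy f u i) := by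
      have h3 : ∑ i ∈ S, ∑ k, pairSum f (square u i k) = 2 * ∑ i ∈ S, siteEnergy f u i := by
        rw [Finset.mul_sum]
        refine Finset.sum_congr rfl fun i _ => ?_
        rw [siteEnergy]
        ring
      rw [← Finset.mul_sum, Finset.sum_product, h3]
    have h4 := mul_le_mul_of_nonneg_left (hJ.trans (h1.trans h2.le))
      (by positivity : (0 : ℝ) ≤ 3 / 2 * S.card)
    refine le_trans (le_of_eq (by ring)) (h4.trans (le_of_eq ?_))
    field_simp

theorem eventually_card_pos (hA : JordanMeasurable A) (hvol : 0 < volume.real A) :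
    ∀ᶠ ε in 𝓝[>] (0 : ℝ), (latticeFinset ε A).Nonempty := by
  have h := (tendsto_card hA).eventually (lt_mem_nhds hvol)
  filter_upwards [h] with ε h
  rw [← Finset.card_pos]
  by_contra h0
  have : (latticeFinset ε A).card = 0 := by omega
  simp [this] at h

/-- Asymptotic form of `exists_env_le_sum_siteEnergy` on the lattice points of a set. -/
theorem eventually_exists_env_le (hf : ∀ u v, |f u v| ≤ C) (hA : JordanMeasurable A)
    (hvol : 0 < volume.real A) {δ : ℝ} (hδ : 0 < δ) :
    ∀ᶠ ε in 𝓝[>] (0 : ℝ), (latticeFinset ε A).Nonempty ∧ ∀ u : Z3 → S2, ∃ P ∈ K,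
      ‖P - ((latticeFinset ε A).card : ℝ)⁻¹ • ∑ i ∈ latticeFinset ε A, tensor (u i)‖ ≤ δ ∧
      3 / 2 * (ε ^ 3 * (latticeFinset ε A).card * env f P) ≤
        ε ^ 3 * ∑ i ∈ latticeFinset ε A, siteEnergy f u i := by
  have hlim : Tendsto (fun ε : ℝ => 2 * ((ε ^ 3 * (bnd (latticeFinset ε A)).card) /
      (ε ^ 3 * (latticeFinset ε A).card))) (𝓝[>] 0) (𝓝 (2 * (0 / volume.real A))) :=
    ((tendsto_card_bnd hA).div (tendsto_card hA) hvol.ne').const_mul 2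
  rw [zero_div, mul_zero] at hlim
  filter_upwards [eventually_card_pos hA hvol, hlim.eventually (gt_mem_nhds hδ),
    self_mem_nhdsWithin] with ε hS hlt hε
  have hε : 0 < ε := hε
  refine ⟨hS, fun u => ?_⟩
  obtain ⟨P, hP, h1, h2⟩ := exists_env_le_sum_siteEnergy hf hS u
  refine ⟨P, hP, h1.trans ?_, ?_⟩
  · rw [mul_div_mul_left _ _ (by positivity)] at hlt
    exact hlt.le
  · have := mul_le_mul_of_nonneg_left h2 (by positivity : 0 ≤ ε ^ 3)
    linarith

/-! ### Recovery on a set -/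

/-- On the lattice points of `A` there are spin fields with mean tensor close to `P` and with
energy density at most about `3 / 2 * t`. -/
def Recoverable (f : S2 → S2 → ℝ) (A : Set E3) (P : Sym3) (t : ℝ) : Prop :=
  ∀ δ > 0, ∀ᶠ ε in 𝓝[>] (0 : ℝ), ∃ u : Z3 → S2,
    ‖ε ^ 3 • ∑ i ∈ latticeFinset ε A, tensor (u i) - volume.real A • P‖ ≤ δ ∧
    ε ^ 3 * ∑ i ∈ latticeFinset ε A, siteEnergy f u i ≤ 3 / 2 * (t * volume.real A) + δ

theorem two_mul_pairSum (hsymm : ∀ u v, f u v = f v u) (u : Fin 4 → S2) :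
    2 * pairSum f u = ∑ i, ∑ j, f (u i) (u j) - ∑ i, f (u i) (u i) := by
  rw [pairSum_eq]
  simp only [Fin.sum_univ_four]
  rw [hsymm (u 1) (u 0), hsymm (u 2) (u 0), hsymm (u 3) (u 0), hsymm (u 2) (u 1),
    hsymm (u 3) (u 1), hsymm (u 3) (u 2)]
  ring

theorem pairSum_comp_perm (hsymm : ∀ u v, f u v = f v u) (u : Fin 4 → S2)
    (σ : Equiv.Perm (Fin 4)) : pairSum f (u ∘ σ) = pairSum f u := by
  have h1 := two_mul_pairSum hsymm u
  have h2 := two_mul_pairSum hsymm (u ∘ σ)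
  have h3 : ∑ i, ∑ j, f ((u ∘ σ) i) ((u ∘ σ) j) = ∑ i, ∑ j, f (u i) (u j) := by
    rw [← Equiv.sum_comp σ fun i => ∑ j, f (u i) (u j)]
    exact Finset.sum_congr rfl fun i _ => Equiv.sum_comp σ fun j => f (u (σ i)) (u j)
  have h4 : ∑ i, f ((u ∘ σ) i) ((u ∘ σ) i) = ∑ i, f (u i) (u i) :=
    Equiv.sum_comp σ fun i => f (u i) (u i)
  linarith

theorem avg4_comp_perm (u : Fin 4 → S2) (σ : Equiv.Perm (Fin 4)) : avg4 (u ∘ σ) = avg4 u := by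
  rw [avg4, avg4]
  congr 1
  exact Equiv.sum_comp σ fun i => tensor (u i)

/-- A numbering of the four elements of `(ℤ/2)²`. -/
def colourCode (p q : ZMod 2) : Fin 4 := if p = 0 then (if q = 0 then 0 else 1) else
  (if q = 0 then 2 else 3)

/-- The `2`-periodic colouring of the lattice by the homomorphism to `(ℤ/2)²` that sends the three
unit vectors to the three nonzero elements. -/
def colour (i : Z3) : Fin 4 := colourCode ((i 0 : ZMod 2) + i 2) ((i 1 : ZMod 2) + i 2)

/-- Every lattice square shows all four colours. -/
theorem exists_perm_square_colour (v : Fin 4 → S2) (i : Z3) (k : Fin 3) :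
    ∃ σ : Equiv.Perm (Fin 4), square (fun i => v (colour i)) i k = v ∘ σ := by
  obtain ⟨g, hg, hsq⟩ : ∃ g : Fin 4 → Fin 4, Function.Injective g ∧
      square (fun i => v (colour i)) i k = v ∘ g := by
    refine ⟨![colour i, colour (i + (edges k).1), colour (i + (edges k).2),
      colour (i + ((edges k).1 + (edges k).2))], ?_, ?_⟩
    · have key : ∀ a b c : ZMod 2, ∀ k : Fin 3, Function.Injective
          ![colourCode (a + c) (b + c),
            colourCode (a + ((edges k).1 0 : ZMod 2) + (c + ((edges k).1 2 : ZMod 2)))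
              (b + ((edges k).1 1 : ZMod 2) + (c + ((edges k).1 2 : ZMod 2))),
            colourCode (a + ((edges k).2 0 : ZMod 2) + (c + ((edges k).2 2 : ZMod 2)))
              (b + ((edges k).2 1 : ZMod 2) + (c + ((edges k).2 2 : ZMod 2))),
            colourCode (a + (((edges k).1 0 : ZMod 2) + ((edges k).2 0 : ZMod 2)) +
                (c + (((edges k).1 2 : ZMod 2) + ((edges k).2 2 : ZMod 2))))
              (b + (((edges k).1 1 : ZMod 2) + ((edges k).2 1 : ZMod 2)) +
                (c + (((edges k).1 2 : ZMod 2) + ((edges k).2 2 : ZMod 2))))] := by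
        decide +kernel
      have := key (i 0) (i 1) (i 2) k
      simpa only [colour, Pi.add_apply, Int.cast_add] using this
    · funext c
      fin_cases c <;> rfl
  exact ⟨Equiv.ofBijective g (Finite.injective_iff_bijective.1 hg), hsq⟩

/-- A point above the value of a quadruple is recovered by the periodic arrangement of the four
vectors according to `colour`. -/
theorem recoverable_of_mem_quadEpi (hsymm : ∀ u v, f u v = f v u)
    (hA : JordanMeasurable A) {P : Sym3} {t : ℝ} (h : (P, t) ∈ quadEpi f) :
    Recoverable f A P t := by
  obtain ⟨v, rfl, hv⟩ := h
  simp only at hv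
  intro δ hδ
  set u : Z3 → S2 := fun i => v (colour i)
  have havg (i : Z3) (k : Fin 3) : avg4 (square u i k) = avg4 v := by
    obtain ⟨σ, hσ⟩ := exists_perm_square_colour v i k
    rw [hσ, avg4_comp_perm]
  have hsite (i : Z3) : siteEnergy f u i = 3 / 2 * pairSum f v := by
    have h (k : Fin 3) : pairSum f (square u i k) = pairSum f v := by
      obtain ⟨σ, hσ⟩ := exists_perm_square_colour v i k
      rw [hσ, pairSum_comp_perm hsymm]
    rw [siteEnergy, Fin.sum_univ_three, h, h, h]
    ring
  have hlim1 : Tendsto (fun ε : ℝ => 2 * (ε ^ 3 * (bnd (latticeFinset ε A)).card) +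
      |ε ^ 3 * (latticeFinset ε A).card - volume.real A|) (𝓝[>] 0) (𝓝 (2 * 0 + 0)) := by
    refine ((tendsto_card_bnd hA).const_mul 2).add ?_
    have := ((tendsto_card hA).sub_const (volume.real A)).abs
    simpa using this
  have hlim2 : Tendsto (fun ε : ℝ => ε ^ 3 * (latticeFinset ε A).card * (3 / 2 * pairSum f v))
      (𝓝[>] 0) (𝓝 (volume.real A * (3 / 2 * pairSum f v))) := (tendsto_card hA).mul_const _
  rw [mul_zero, zero_add] at hlim1
  have hlt : volume.real A * (3 / 2 * pairSum f v) < 3 / 2 * (t * volume.real A) + δ := by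
    have := mul_le_mul_of_nonneg_left hv (measureReal_nonneg (μ := volume) (s := A))
    linarith
  filter_upwards [hlim1.eventually (gt_mem_nhds hδ), hlim2.eventually (gt_mem_nhds hlt),
    self_mem_nhdsWithin] with ε h1 h2 hε
  have hε : 0 < ε := hε
  refine ⟨u, ?_, ?_⟩
  · set S := latticeFinset ε A
    have h3 := norm_sum_avg4_corners_sub_le u S (isNbr_edges 0).1 (isNbr_edges 0).2.1
      (isNbr_edges 0).2.2
    have h4 : ∑ i ∈ S, avg4 (corners u (edges 0).1 (edges 0).2 i) = (S.card : ℝ) • avg4 v := by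
      rw [Nat.cast_smul_eq_nsmul ℝ, ← Finset.sum_const]
      exact Finset.sum_congr rfl fun i _ => havg i 0
    rw [h4, norm_sub_rev] at h3
    have h5 : ε ^ 3 • ∑ i ∈ S, tensor (u i) - volume.real A • avg4 v =
        ε ^ 3 • (∑ i ∈ S, tensor (u i) - (S.card : ℝ) • avg4 v) +
        (ε ^ 3 * S.card - volume.real A) • avg4 v := by module
    rw [h5]
    refine (norm_add_le _ _).trans (le_trans (add_le_add ?_ ?_) h1.le)
    · rw [norm_smul, Real.norm_of_nonneg (by positivity)]
      have := mul_le_mul_of_nonneg_left h3 (by positivity : 0 ≤ ε ^ 3)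
      linarith
    · rw [norm_smul, Real.norm_eq_abs]
      exact mul_le_of_le_one_right (abs_nonneg _) (norm_le_one_of_mem_K (avg4_mem_K v))
  · simp only [hsite, Finset.sum_const, nsmul_eq_mul]
    rw [← mul_assoc]
    exact h2.le

/-! ### Gluing and mixing of spin fields -/

/-- The energy of the sites of `S` depends, up to a boundary term, only on the spins in `S`. -/
theorem abs_sum_siteEnergy_sub_le (hf : ∀ u v, |f u v| ≤ C) {S : Finset Z3} {u v : Z3 → S2}
    (h : ∀ i ∈ S, u i = v i) :
    |∑ i ∈ S, siteEnergy f u i - ∑ i ∈ S, siteEnergy f v i| ≤ 18 * (C * (bnd S).card) := by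
  have hsite (i : Z3) (hi : i ∈ S) (hb : i ∉ bnd S) : siteEnergy f u i = siteEnergy f v i := by
    have hin (d : Z3) (hd : IsNbr d) : u (i + d) = v (i + d) := by
      refine h _ ?_
      by_contra hid
      exact hb (mem_bnd.2 ⟨hi, d, hd, hid⟩)
    have hsq (k : Fin 3) : square u i k = square v i k := by
      obtain ⟨h1, h2, h3⟩ := isNbr_edges k
      rw [square, square, corners, corners, h i hi, hin _ h1, hin _ h2, hin _ h3]
    simp only [siteEnergy, hsq]
  have hsub : bnd S ⊆ S := fun i hi => (mem_bnd.1 hi).1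
  rw [← Finset.sum_sub_distrib, ← Finset.sum_subset hsub fun i hi hb => by
    rw [hsite i hi hb, sub_self]]
  refine (Finset.abs_sum_le_sum_abs _ _).trans ?_
  refine (Finset.sum_le_sum (g := fun _ => 18 * C) fun i _ => ?_).trans (le_of_eq ?_)
  · have h1 := abs_siteEnergy_le hf u i
    have h2 := abs_siteEnergy_le hf v i
    have h3 := abs_sub (siteEnergy f u i) (siteEnergy f v i)
    linarith
  · rw [Finset.sum_const, nsmul_eq_mul]
    ring

theorem sum_latticeFinset_eq {ι M : Type*} [AddCommMonoid M] (J : Finset ι) (B : ι → Set E3)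
    (hdisj : (J : Set ι).PairwiseDisjoint B) (hA : Bornology.IsBounded A)
    (hcover : A = ⋃ j ∈ J, B j) {ε : ℝ} (hε : 0 < ε) (F : Z3 → M) :
    ∑ i ∈ latticeFinset ε A, F i = ∑ j ∈ J, ∑ i ∈ latticeFinset ε (B j), F i := by
  classical
  have hB (j : ι) (hj : j ∈ J) : Bornology.IsBounded (B j) :=
    hA.subset (hcover ▸ Set.subset_biUnion_of_mem (u := B) hj)
  rw [← Finset.sum_biUnion]
  · refine Finset.sum_congr ?_ fun _ _ => rfl
    ext i
    rw [mem_latticeFinset hε hA, hcover]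
    simp only [Set.mem_iUnion, Finset.mem_biUnion, exists_prop]
    exact exists_congr fun j => and_congr_right fun hj => (mem_latticeFinset hε (hB j hj)).symm
  · intro j hj k hk hjk
    refine Finset.disjoint_left.2 fun i hij hik => ?_
    rw [mem_latticeFinset hε (hB _ hj)] at hij
    rw [mem_latticeFinset hε (hB _ hk)] at hik
    exact Set.disjoint_left.1 (hdisj hj hk hjk) hij hik

/-- Spin fields on finitely many disjoint sets can be glued. -/
theorem Recoverable.glue (hf : ∀ u v, |f u v| ≤ C) {ι : Type*} (J : Finset ι) (B : ι → Set E3)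
    (hdisj : (J : Set ι).PairwiseDisjoint B) (hB : ∀ j ∈ J, JordanMeasurable (B j))
    (P : ι → Sym3) (t : ι → ℝ) (h : ∀ j ∈ J, Recoverable f (B j) (P j) (t j)) {δ : ℝ}
    (hδ : 0 < δ) :
    ∀ᶠ ε in 𝓝[>] (0 : ℝ), ∃ u : Z3 → S2, ∀ j ∈ J,
      ‖ε ^ 3 • ∑ i ∈ latticeFinset ε (B j), tensor (u i) - volume.real (B j) • P j‖ ≤ δ ∧
      ε ^ 3 * ∑ i ∈ latticeFinset ε (B j), siteEnergy f u i ≤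
        3 / 2 * (t j * volume.real (B j)) + δ := by
  classical
  have hev1 : ∀ᶠ ε in 𝓝[>] (0 : ℝ), ∀ j ∈ J, ∃ u : Z3 → S2,
      ‖ε ^ 3 • ∑ i ∈ latticeFinset ε (B j), tensor (u i) - volume.real (B j) • P j‖ ≤ δ / 2 ∧
      ε ^ 3 * ∑ i ∈ latticeFinset ε (B j), siteEnergy f u i ≤
        3 / 2 * (t j * volume.real (B j)) + δ / 2 :=
    (Finset.eventually_all J).2 fun j hj => h j hj _ (half_pos hδ)
  have hev2 : ∀ᶠ ε in 𝓝[>] (0 : ℝ), ∀ j ∈ J,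
      18 * C * (ε ^ 3 * (bnd (latticeFinset ε (B j))).card) < δ / 2 := by
    refine (Finset.eventually_all J).2 fun j hj => ?_
    have := (tendsto_card_bnd (hB j hj)).const_mul (18 * C)
    rw [mul_zero] at this
    exact this.eventually (gt_mem_nhds (half_pos hδ))
  filter_upwards [hev1, hev2, self_mem_nhdsWithin] with ε h1 h2 hε
  have hε : 0 < ε := hε
  let v₀ : S2 := ⟨EuclideanSpace.single 0 1, by simp⟩
  have : Nonempty (Z3 → S2) := ⟨fun _ => v₀⟩
  choose! v hv using h1
  let u (i : Z3) : S2 := if h : ∃ j ∈ J, latticePoint ε i ∈ B j then v h.choose i else v₀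
  have hu (j : ι) (hj : j ∈ J) (i : Z3) (hi : i ∈ latticeFinset ε (B j)) : u i = v j i := by
    rw [mem_latticeFinset hε (hB j hj).bounded] at hi
    have hex : ∃ j ∈ J, latticePoint ε i ∈ B j := ⟨j, hj, hi⟩
    have heq : hex.choose = j := by
      by_contra hne
      exact Set.disjoint_left.1 (hdisj hex.choose_spec.1 hj hne) hex.choose_spec.2 hi
    simp only [u, dif_pos hex, heq]
  refine ⟨u, fun j hj => ?_⟩
  obtain ⟨h3, h4⟩ := hv j hj
  constructor
  · rw [Finset.sum_congr rfl fun i hi => by rw [hu j hj i hi]]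
    exact h3.trans (by linarith)
  · have h5 := (abs_le.1 (abs_sum_siteEnergy_sub_le hf (hu j hj))).2
    have h6 := mul_le_mul_of_nonneg_left h5 (by positivity : 0 ≤ ε ^ 3)
    have h7 := h2 j hj
    linarith

theorem null_frontier_halfspace (s : ℝ) : volume (frontier {x : E3 | x 2 < s}) = 0 := by
  have : {x : E3 | x 2 < s} =
      (EuclideanSpace.proj (𝕜 := ℝ) 2 : E3 →L[ℝ] ℝ) ⁻¹' Set.Iio s := by
    ext; simp
  rw [this]
  exact Convex.addHaar_frontier volume ((convex_Iio _).is_linear_preimage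
    (EuclideanSpace.proj (𝕜 := ℝ) 2 : E3 →L[ℝ] ℝ).isLinear)

theorem measurableSet_halfspace (s : ℝ) : MeasurableSet {x : E3 | x 2 < s} := by
  have hk : Measurable fun x : E3 => x 2 := by fun_prop
  exact measurableSet_lt hk measurable_const

/-- A half-space cuts off any prescribed fraction of the volume. -/
theorem exists_halfspace_volume_eq (hA : JordanMeasurable A) {a : ℝ} (ha0 : 0 ≤ a) (ha1 : a ≤ 1) :
    ∃ s : ℝ, volume.real (A ∩ {x | x 2 < s}) = a * volume.real A := by
  let F (s : ℝ) : ℝ := ∫ x in A, Set.indicator {x : E3 | x 2 < s} (fun _ => (1 : ℝ)) x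
  have hF (s : ℝ) : F s = volume.real (A ∩ {x | x 2 < s}) := by
    have hs := measurableSet_halfspace s
    simp only [F]
    rw [integral_indicator hs, Measure.restrict_restrict hs, setIntegral_const, smul_eq_mul,
      mul_one, Set.inter_comm]
  have : IsFiniteMeasure (volume.restrict A) := ⟨by simpa using hA.volume_lt_top⟩
  have hcont : Continuous F := by
    refine continuous_iff_continuousAt.2 fun s => ?_
    refine continuousAt_of_dominated (bound := fun _ => 1) ?_ ?_ (integrable_const _) ?_
    · exact Eventually.of_forall fun r =>
        (measurable_const.indicator (measurableSet_halfspace r)).aestronglyMeasurable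
    · refine Eventually.of_forall fun r => Eventually.of_forall fun x => ?_
      by_cases hx : x ∈ {x : E3 | x 2 < r} <;> simp [hx]
    · have hnull : volume {x : E3 | x 2 = s} = 0 :=
        volume_graph_eq_zero (γ := fun _ => s) continuous_const
      have hne : ∀ᵐ x ∂volume.restrict A, x 2 ≠ s :=
        ae_restrict_of_ae (measure_eq_zero_iff_ae_notMem.1 hnull)
      filter_upwards [hne] with x hx
      rcases lt_or_gt_of_ne hx with hlt | hgt
      · refine (continuousAt_const (y := (1 : ℝ))).congr ?_
        filter_upwards [lt_mem_nhds hlt] with r hr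
        rw [Set.indicator_of_mem (show x ∈ {x : E3 | x 2 < r} from hr)]
      · refine (continuousAt_const (y := (0 : ℝ))).congr ?_
        filter_upwards [gt_mem_nhds hgt] with r hr
        rw [Set.indicator_of_notMem (show x ∉ {x : E3 | x 2 < r} from not_lt.2 hr.le)]
  -- `F` increases continuously from `0` to the volume of `A`.
  obtain ⟨R, hR⟩ := hA.bounded.subset_closedBall 0
  have hbd (x : E3) (hx : x ∈ A) : |x 2| ≤ |R| := by
    have := PiLp.norm_apply_le x 2
    have h2 : ‖x‖ ≤ R := by simpa using hR hx
    exact this.trans (h2.trans (le_abs_self R))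
  have h0 : F (-|R|) = 0 := by
    rw [hF]
    have : A ∩ {x | x 2 < -|R|} = ∅ := by
      ext x
      simp only [Set.mem_inter_iff, Set.mem_ofPred_eq, Set.mem_empty_iff_false, iff_false, not_and,
        not_lt]
      exact fun hx => (abs_le.1 (hbd x hx)).1
    rw [this, measureReal_empty]
  have h1 : F (|R| + 1) = volume.real A := by
    rw [hF]
    congr 1
    refine Set.inter_eq_left.2 fun x hx => ?_
    have := (abs_le.1 (hbd x hx)).2
    exact lt_of_le_of_lt this (by linarith)
  have hV : 0 ≤ volume.real A := measureReal_nonneg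
  obtain ⟨s, -, hs⟩ := intermediate_value_Icc (by linarith [abs_nonneg R] : -|R| ≤ |R| + 1)
    hcont.continuousOn (show a * volume.real A ∈ Set.Icc (F (-|R|)) (F (|R| + 1)) by
      rw [h0, h1]
      exact ⟨by positivity, mul_le_of_le_one_left hV ha1⟩)
  exact ⟨s, by rw [← hF, hs]⟩

/-- Mixing on a macroscopic scale: the two spin fields are used on the two sides of a plane. -/
theorem convex_recoverable (hf : ∀ u v, |f u v| ≤ C) :
    Convex ℝ {p : Sym3 × ℝ | ∀ A, JordanMeasurable A → Recoverable f A p.1 p.2} := by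
  rintro ⟨P, s⟩ hP ⟨Q, t⟩ hQ a b ha hb hab A hA δ hδ
  obtain ⟨r, hr⟩ := exists_halfspace_volume_eq hA ha (by linarith)
  set H : Set E3 := {x | x 2 < r}
  let B (c : Bool) : Set E3 := A ∩ if c then H else Hᶜ
  have hBJ (c : Bool) : JordanMeasurable (B c) := by
    refine hA.inter ?_
    cases c
    · simpa [frontier_compl] using null_frontier_halfspace r
    · simpa using null_frontier_halfspace r
  have hdisj : ((Finset.univ : Finset Bool) : Set Bool).PairwiseDisjoint B := by
    intro c _ d _ hcd
    refine Set.disjoint_left.2 fun x hx hx' => ?_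
    cases c <;> cases d <;> simp [B] at hcd hx hx' <;> tauto
  have hcover : A = ⋃ c ∈ (Finset.univ : Finset Bool), B c := by
    ext x
    simp [B, em']
  have hBt : volume.real (B true) = a * volume.real A := by simpa [B] using hr
  have hBf : volume.real (B false) = b * volume.real A := by
    have h := measureReal_inter_add_sdiff (μ := volume) (s := A)
      (measurableSet_halfspace r) hA.volume_lt_top.ne
    have h2 : B false = A \ H := by simp [B, Set.sdiff_eq]
    rw [hr] at h
    rw [h2]
    have h3 : volume.real A = (a + b) * volume.real A := by rw [hab, one_mul]
    linarith
  have hglue := Recoverable.glue hf Finset.univ B hdisj (fun c _ => hBJ c)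
    (fun c => if c then P else Q) (fun c => if c then s else t)
    (fun c _ => by cases c; exacts [hQ _ (hBJ _), hP _ (hBJ _)]) (half_pos hδ)
  filter_upwards [hglue, self_mem_nhdsWithin] with ε hglue hε
  obtain ⟨u, hu⟩ := hglue
  have h1 := hu true (Finset.mem_univ _)
  have h2 := hu false (Finset.mem_univ _)
  simp only [if_true, hBt, hBf, Bool.false_eq_true, if_false] at h1 h2
  refine ⟨u, ?_, ?_⟩
  · rw [sum_latticeFinset_eq Finset.univ B hdisj hA.bounded hcover hε, Fintype.sum_bool]
    have e : ε ^ 3 • (∑ i ∈ latticeFinset ε (B true), tensor (u i) +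
        ∑ i ∈ latticeFinset ε (B false), tensor (u i)) -
        volume.real A • (a • (P, s) + b • (Q, t)).1 =
        (ε ^ 3 • ∑ i ∈ latticeFinset ε (B true), tensor (u i) - (a * volume.real A) • P) +
        (ε ^ 3 • ∑ i ∈ latticeFinset ε (B false), tensor (u i) - (b * volume.real A) • Q) := by
      simp only [Prod.fst_add, Prod.smul_fst]
      module
    rw [e]
    exact (norm_add_le _ _).trans (by linarith [h1.1, h2.1])
  · rw [sum_latticeFinset_eq Finset.univ B hdisj hA.bounded hcover hε, Fintype.sum_bool]
    simp only [Prod.snd_add, Prod.smul_snd, smul_eq_mul]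
    linarith [h1.2, h2.2]

theorem isClosed_recoverable :
    IsClosed {p : Sym3 × ℝ | ∀ A, JordanMeasurable A → Recoverable f A p.1 p.2} := by
  refine isClosed_of_closure_subset ?_
  rintro ⟨P, t⟩ hPt A hA δ hδ
  set V := volume.real A
  have hV : 0 ≤ V := measureReal_nonneg
  obtain ⟨⟨R, r⟩, hR, hdist⟩ := Metric.mem_closure_iff.1 hPt (δ / (2 * (2 * V + 1))) (by positivity)
  rw [Prod.dist_eq, max_lt_iff, dist_eq_norm, Real.dist_eq, lt_div_iff₀ (by positivity),
    lt_div_iff₀ (by positivity)] at hdist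
  obtain ⟨h1, h2⟩ := hdist
  have h3 : r - t ≤ |t - r| := by rw [abs_sub_comm]; exact le_abs_self _
  filter_upwards [hR A hA (δ / 4) (by positivity)] with ε hε
  obtain ⟨u, hu1, hu2⟩ := hε
  refine ⟨u, ?_, hu2.trans ?_⟩
  · have e : ε ^ 3 • ∑ i ∈ latticeFinset ε A, tensor (u i) - V • P =
        (ε ^ 3 • ∑ i ∈ latticeFinset ε A, tensor (u i) - V • R) - V • (P - R) := by module
    rw [e]
    refine (norm_sub_le _ _).trans ?_
    rw [norm_smul, Real.norm_of_nonneg hV]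
    nlinarith [norm_nonneg (P - R)]
  · nlinarith [abs_nonneg (t - r)]

/-- Every point above the envelope is recoverable on every Jordan measurable set. -/
theorem recoverable_of_mem_hullEpi (hf : ∀ u v, |f u v| ≤ C) (hsymm : ∀ u v, f u v = f v u)
    (hA : JordanMeasurable A) {P : Sym3} {t : ℝ} (h : (P, t) ∈ hullEpi f) :
    Recoverable f A P t :=
  hullEpi_subset (convex_recoverable hf) isClosed_recoverable
    (fun _ hp _ hA => recoverable_of_mem_quadEpi hsymm hA hp) h A hA

/-! ### The homogenized density -/

theorem tendsto_coe_of_forall_eventually {α : Type*} {l : Filter α} {F : α → EReal} {m : ℝ}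
    (h : ∀ δ > 0, ∀ᶠ x in l, ((m - δ : ℝ) : EReal) ≤ F x ∧ F x ≤ ((m + δ : ℝ) : EReal)) :
    Tendsto F l (𝓝 (m : EReal)) := by
  refine tendsto_order.2 ⟨fun a ha => ?_, fun a ha => ?_⟩
  · obtain ⟨x, hax, hx⟩ := EReal.lt_iff_exists_real_btwn.1 ha
    have hx := EReal.coe_lt_coe_iff.1 hx
    filter_upwards [h (m - x) (by linarith)] with y hy
    rw [sub_sub_cancel] at hy
    exact hax.trans_le hy.1
  · obtain ⟨x, hx, hax⟩ := EReal.lt_iff_exists_real_btwn.1 ha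
    have hx := EReal.coe_lt_coe_iff.1 hx
    filter_upwards [h (x - m) (by linarith)] with y hy
    rw [add_sub_cancel] at hy
    exact hy.2.trans_lt hax

theorem latticeIn_cube {h : ℝ} (hh : 0 < h) : latticeIn 1 (cube h) = latticeIn h⁻¹ (cube 1) := by
  ext i
  refine forall_congr' fun k => ?_
  have e1 : latticePoint 1 i k = i k := by simp [latticePoint]
  have e2 : latticePoint h⁻¹ i k = i k / h := by simp [latticePoint, div_eq_inv_mul]
  rw [e1, e2, le_div_iff₀ hh, div_lt_iff₀ hh]
  refine and_congr ?_ ?_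
  · rw [show -(1 / 2) * h = -(h / 2) by ring]
  · rw [show 1 / 2 * h = h / 2 by ring]

/-- The scaled lattice energy on the lattice points of a set and the scaled sum of the energies of
these sites have the same asymptotics, uniformly in the spin field. -/
theorem eventually_abs_latticeEnergy_sub_le (hf : ∀ u v, |f u v| ≤ C)
    (hsymm : ∀ u v, f u v = f v u) (hA : JordanMeasurable A) {δ : ℝ} (hδ : 0 < δ) :
    ∀ᶠ ε in 𝓝[>] (0 : ℝ), ∀ u : Z3 → S2,
      |ε ^ 3 * latticeEnergy f (latticeIn ε A) u -
        ε ^ 3 * ∑ i ∈ latticeFinset ε A, siteEnergy f u i| ≤ δ := by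
  have hlim := (tendsto_card_bnd hA).const_mul (36 * C)
  rw [mul_zero] at hlim
  filter_upwards [hlim.eventually (gt_mem_nhds hδ), self_mem_nhdsWithin] with ε h1 hε u
  have hε : 0 < ε := hε
  rw [← coe_latticeFinset hε hA.bounded, ← mul_sub, abs_mul, abs_of_pos (by positivity)]
  have h2 := mul_le_mul_of_nonneg_left
    (abs_latticeEnergy_sub_le hf hsymm (latticeFinset ε A) u) (by positivity : 0 ≤ ε ^ 3)
  linarith

theorem norm_mean_tensor_le (S : Finset Z3) (u : Z3 → S2) :
    ‖(S.card : ℝ)⁻¹ • ∑ i ∈ S, tensor (u i)‖ ≤ 1 := by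
  rw [norm_smul, norm_inv, Real.norm_natCast]
  have h : ‖∑ i ∈ S, tensor (u i)‖ ≤ ∑ _i ∈ S, (1 : ℝ) :=
    norm_sum_le_of_le _ fun i _ => (norm_tensor _).le
  rw [Finset.sum_const, nsmul_eq_mul, mul_one] at h
  exact (mul_le_mul_of_nonneg_left h (by positivity)).trans (inv_mul_le_one (a := (S.card : ℝ)))

theorem discreteAverage_eq {h : ℝ} (hh : 0 < h) (u : Z3 → S2) :
    discreteAverage u h = ((latticeFinset h⁻¹ (cube 1)).card : ℝ)⁻¹ •
      ∑ i ∈ latticeFinset h⁻¹ (cube 1), tensor (u i) := by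
  have hb := (jordanMeasurable_cube one_pos).bounded
  rw [discreteAverage, latticeIn_cube hh, ← coe_latticeFinset (inv_pos.2 hh) hb,
    Set.ncard_coe_finset, finsum_mem_coe_finset]

/-- The infimum of the envelope over the matrices in `K` at distance at most `ρ` from `Q`. -/
def ballInf (f : S2 → S2 → ℝ) (Q : Sym3) (ρ : ℝ) : ℝ := sInf (env f '' (K ∩ Metric.closedBall Q ρ))

theorem ballInf_le (hf : ∀ u v, |f u v| ≤ C) {Q P : Sym3} {ρ : ℝ} (hP : P ∈ K)
    (hPQ : P ∈ Metric.closedBall Q ρ) : ballInf f Q ρ ≤ env f P := by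
  refine csInf_le ⟨-(6 * C), ?_⟩ ⟨P, ⟨hP, hPQ⟩, rfl⟩
  rintro _ ⟨R, hR, rfl⟩
  exact (abs_le.1 (abs_env_le hf hR.1)).1

theorem volume_real_cube_one : volume.real (cube 1) = 1 := by
  rw [Measure.real, volume_cube zero_le_one]
  simp

theorem tendsto_card_cube :
    Tendsto (fun ε : ℝ => |ε ^ 3 * (latticeFinset ε (cube 1)).card - 1|) (𝓝[>] 0) (𝓝 0) := by
  have := (tendsto_card (jordanMeasurable_cube one_pos)).sub_const 1
  rw [volume_real_cube_one, sub_self] at this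
  simpa using this.abs

theorem eventually_le_cellInf (hf : ∀ u v, |f u v| ≤ C) (hsymm : ∀ u v, f u v = f v u)
    (Q : Sym3) (ρ : ℝ) {δ : ℝ} (hδ : 0 < δ) :
    ∀ᶠ h in atTop, ((3 / 2 * ballInf f Q ρ - δ : ℝ) : EReal) ≤ cellInf f Q ρ h := by
  have hJ := jordanMeasurable_cube one_pos
  have hC := nonneg_of_bound hf
  set m := ballInf f Q ρ
  -- By compactness the lower bound for the envelope persists near the ball.
  obtain ⟨r, hr, hsub⟩ := (isCompact_closedBall Q ρ).exists_cthickening_subset_open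
    (isClosed_sublevel hf (m - δ / 6)).isOpen_compl (fun P hP hP' => by
      have := ballInf_le hf hP'.1 hP
      have := hP'.2
      simp only [m] at this
      linarith)
  have hev := (eventually_exists_env_le hf hJ (by rw [volume_real_cube_one]; exact one_pos) hr).and
    ((eventually_abs_latticeEnergy_sub_le hf hsymm hJ (by positivity : 0 < δ / 4)).and
      (tendsto_card_cube.eventually (gt_mem_nhds (by positivity : 0 < δ / (36 * (C + 1))))))
  filter_upwards [tendsto_inv_atTop_nhdsGT_zero.eventually hev, eventually_gt_atTop 0] with h h1 hh
  obtain ⟨⟨-, h1⟩, h2, h3⟩ := h1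
  refine le_iInf₂ fun u hu => EReal.coe_le_coe_iff.2 ?_
  obtain ⟨P, hP, hPu, hE⟩ := h1 u
  rw [discreteAverage_eq hh] at hu
  have henv : m - δ / 6 < env f P := by
    by_contra hle
    refine hsub (Metric.mem_cthickening_of_dist_le P _ r _ hu ?_) ⟨hP, not_lt.1 hle⟩
    rwa [dist_eq_norm]
  have h4 := (abs_le.1 (h2 u)).1
  rw [latticeIn_cube hh, div_eq_inv_mul (latticeEnergy _ _ _), ← inv_pow]
  set N := h⁻¹ ^ 3 * ((latticeFinset h⁻¹ (cube 1)).card : ℝ)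
  have h5 : |(N - 1) * env f P| ≤ δ / 6 := by
    rw [abs_mul]
    have h6 : |N - 1| * |env f P| ≤ δ / (36 * (C + 1)) * (6 * C) :=
      mul_le_mul h3.le (abs_env_le hf hP) (abs_nonneg _) (by positivity)
    refine h6.trans ?_
    rw [div_mul_eq_mul_div, div_le_iff₀ (by positivity)]
    nlinarith
  have h7 := (abs_le.1 h5).1
  nlinarith

theorem eventually_cellInf_le (hf : ∀ u v, |f u v| ≤ C) (hsymm : ∀ u v, f u v = f v u)
    {Q : Sym3} (hQ : Q ∈ K) {ρ : ℝ} (hρ : 0 < ρ) {δ : ℝ} (hδ : 0 < δ) :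
    ∀ᶠ h in atTop, cellInf f Q ρ h ≤ ((3 / 2 * ballInf f Q ρ + δ : ℝ) : EReal) := by
  have hJ := jordanMeasurable_cube one_pos
  have hC := nonneg_of_bound hf
  obtain ⟨_, ⟨P, ⟨hP, hPQ⟩, rfl⟩, hlt⟩ := Real.lt_sInf_add_pos
    (s := env f '' (K ∩ Metric.closedBall Q ρ))
    ⟨_, Q, ⟨hQ, Metric.mem_closedBall_self hρ.le⟩, rfl⟩ (by positivity : 0 < δ / 6)
  change env f P < ballInf f Q ρ + δ / 6 at hlt
  -- A point of the open ball at which the envelope is not much larger than at `P`.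
  obtain ⟨s, hs0, hs1, hsC⟩ : ∃ s : ℝ, 0 < s ∧ s < 1 ∧ s * (12 * C) ≤ δ / 6 := by
    refine ⟨min (1 / 2) (δ / (72 * (C + 1))), by positivity,
      (min_le_left _ _).trans_lt (by norm_num), ?_⟩
    refine (mul_le_mul_of_nonneg_right (min_le_right _ _) (by positivity)).trans ?_
    rw [div_mul_eq_mul_div, div_le_iff₀ (by positivity)]
    nlinarith
  set R := (1 - s) • P + s • Q
  have hR : R ∈ K := convex_K hP hQ (by linarith) hs0.le (by ring)
  have hRQ : ‖R - Q‖ < ρ := by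
    have e : R - Q = (1 - s) • (P - Q) := by simp only [R]; module
    rw [e, norm_smul, Real.norm_of_nonneg (by linarith)]
    rw [mem_closedBall_iff_norm] at hPQ
    nlinarith
  have hRenv : env f R < ballInf f Q ρ + δ / 3 := by
    have h1 := (convexOn_env hf).2 hP hQ (by linarith : 0 ≤ 1 - s) hs0.le (by ring)
    simp only [smul_eq_mul] at h1
    have h2 := (abs_le.1 (abs_env_le hf hP)).1
    have h3 := (abs_le.1 (abs_env_le hf hQ)).2
    have h4 : s * (env f Q - env f P) ≤ s * (12 * C) :=
      mul_le_mul_of_nonneg_left (by linarith) hs0.le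
    change env f R ≤ _ at h1
    linarith
  set η := min ((ρ - ‖R - Q‖) / 2) (δ / 4)
  have hη : 0 < η := lt_min (by linarith) (by positivity)
  have hev := (recoverable_of_mem_hullEpi hf hsymm hJ ((mem_hullEpi_iff hf).2 ⟨hR, le_rfl⟩) η
    hη).and (((eventually_abs_latticeEnergy_sub_le hf hsymm hJ (by positivity : 0 < δ / 4)).and
      (tendsto_card_cube.eventually (gt_mem_nhds hη))).and
      (eventually_card_pos hJ (by rw [volume_real_cube_one]; exact one_pos)))
  filter_upwards [tendsto_inv_atTop_nhdsGT_zero.eventually hev, eventually_gt_atTop 0] with h h1 hh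
  obtain ⟨⟨u, hu1, hu2⟩, ⟨h2, h3⟩, hne⟩ := h1
  rw [volume_real_cube_one] at hu1 hu2
  have hu : discreteAverage u h ∈ Metric.closedBall Q ρ := by
    rw [discreteAverage_eq hh, mem_closedBall_iff_norm]
    have hN : ((latticeFinset h⁻¹ (cube 1)).card : ℝ) ≠ 0 :=
      (Nat.cast_pos.2 hne.card_pos).ne'
    set T := ∑ i ∈ latticeFinset h⁻¹ (cube 1), tensor (u i)
    set N := ((latticeFinset h⁻¹ (cube 1)).card : ℝ)
    have e : N⁻¹ • T - Q = (R - Q) + (h⁻¹ ^ 3 • T - (1 : ℝ) • R) -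
        (h⁻¹ ^ 3 * N - 1) • (N⁻¹ • T) := by
      rw [sub_smul, smul_smul (h⁻¹ ^ 3 * N), mul_assoc, mul_inv_cancel₀ hN]
      module
    have h4 : ‖(h⁻¹ ^ 3 * N - 1) • (N⁻¹ • T)‖ ≤ η := by
      rw [norm_smul, Real.norm_eq_abs]
      exact (mul_le_of_le_one_right (abs_nonneg _) (norm_mean_tensor_le _ u)).trans h3.le
    rw [e]
    have h5 := norm_sub_le ((R - Q) + (h⁻¹ ^ 3 • T - (1 : ℝ) • R))
      ((h⁻¹ ^ 3 * N - 1) • (N⁻¹ • T))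
    have h6 := norm_add_le (R - Q) (h⁻¹ ^ 3 • T - (1 : ℝ) • R)
    have h7 : η ≤ (ρ - ‖R - Q‖) / 2 := min_le_left _ _
    linarith
  refine (iInf₂_le u hu).trans (EReal.coe_le_coe_iff.2 ?_)
  rw [latticeIn_cube hh, div_eq_inv_mul (latticeEnergy _ _ _), ← inv_pow]
  have h4 := (abs_le.1 (h2 u)).2
  have h5 : η ≤ δ / 4 := min_le_right _ _
  linarith

theorem isHomogenizedValue (hf : ∀ u v, |f u v| ≤ C) (hsymm : ∀ u v, f u v = f v u)
    {Q : Sym3} (hQ : Q ∈ K) :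
    IsHomogenizedValue f Q (((3 / 2 : ℝ) : EReal) * envelope (fHat f) Q) := by
  rw [← coe_env hf hQ, ← EReal.coe_mul]
  refine ⟨fun ρ => ((3 / 2 * ballInf f Q ρ : ℝ) : EReal), fun ρ hρ => ?_, ?_⟩
  · exact tendsto_coe_of_forall_eventually fun δ hδ =>
      (eventually_le_cellInf hf hsymm Q ρ hδ).and (eventually_cellInf_le hf hsymm hQ hρ hδ)
  · refine tendsto_coe_of_forall_eventually fun δ hδ => ?_
    obtain ⟨r, hr, h⟩ := exists_lt_env_of_norm_sub_lt hf
      (show env f Q - δ / 2 < env f Q by linarith)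
    filter_upwards [Ioo_mem_nhdsGT hr] with ρ hρ
    have hQρ : Q ∈ Metric.closedBall Q ρ := Metric.mem_closedBall_self hρ.1.le
    have h1 : env f Q - δ / 2 ≤ ballInf f Q ρ := by
      refine le_csInf ⟨_, Q, ⟨hQ, hQρ⟩, rfl⟩ ?_
      rintro _ ⟨R, hR, rfl⟩
      exact (h R hR.1 ((mem_closedBall_iff_norm.1 hR.2).trans_lt hρ.2)).le
    have h2 := ballInf_le hf hQ hQρ
    rw [EReal.coe_le_coe_iff, EReal.coe_le_coe_iff]
    constructor <;> linarith

/-! ### Lipschitz regularization of the envelope -/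

/-- The largest function below the envelope on `K` that is `L`-Lipschitz. -/
def lipEnv (f : S2 → S2 → ℝ) (L : ℝ) (P : Sym3) : ℝ := ⨅ R : K, (env f R + L * ‖P - R‖)

instance : Nonempty K := ⟨tensor ⟨EuclideanSpace.single 0 1, by simp⟩, tensor_mem_K _⟩

theorem lipEnv_bddBelow (hf : ∀ u v, |f u v| ≤ C) {L : ℝ} (hL : 0 ≤ L) (P : Sym3) :
    BddBelow (Set.range fun R : K => env f R + L * ‖P - R‖) := by
  refine ⟨-(6 * C), ?_⟩
  rintro _ ⟨R, rfl⟩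
  have := (abs_le.1 (abs_env_le hf R.2)).1
  have : 0 ≤ L * ‖P - R‖ := by positivity
  simp only
  linarith

theorem lipEnv_le_env (hf : ∀ u v, |f u v| ≤ C) {L : ℝ} (hL : 0 ≤ L) {P : Sym3} (hP : P ∈ K) :
    lipEnv f L P ≤ env f P := by
  refine (ciInf_le (lipEnv_bddBelow hf hL P) ⟨P, hP⟩).trans (le_of_eq ?_)
  simp

theorem lipEnv_le_add (hf : ∀ u v, |f u v| ≤ C) {L : ℝ} (hL : 0 ≤ L) (P Q : Sym3) :
    lipEnv f L P ≤ lipEnv f L Q + L * ‖P - Q‖ := by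
  rw [← sub_le_iff_le_add]
  refine le_ciInf fun R => ?_
  have h1 : lipEnv f L P ≤ env f R + L * ‖P - R‖ := ciInf_le (lipEnv_bddBelow hf hL P) R
  have h2 := mul_le_mul_of_nonneg_left (norm_sub_le_norm_sub_add_norm_sub P Q R) hL
  linarith

theorem neg_le_lipEnv (hf : ∀ u v, |f u v| ≤ C) {L : ℝ} (hL : 0 ≤ L) (P : Sym3) :
    -(6 * C) ≤ lipEnv f L P := by
  refine le_ciInf fun R => ?_
  have := (abs_le.1 (abs_env_le hf R.2)).1
  have : 0 ≤ L * ‖P - R‖ := by positivity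
  linarith

theorem abs_lipEnv_le (hf : ∀ u v, |f u v| ≤ C) {L : ℝ} (hL : 0 ≤ L) {P : Sym3} (hP : P ∈ K) :
    |lipEnv f L P| ≤ 6 * C :=
  abs_le.2 ⟨neg_le_lipEnv hf hL P,
    (lipEnv_le_env hf hL hP).trans (abs_le.1 (abs_env_le hf hP)).2⟩

theorem continuous_lipEnv (hf : ∀ u v, |f u v| ≤ C) {L : ℝ} (hL : 0 ≤ L) :
    Continuous (lipEnv f L) := by
  refine (LipschitzWith.of_le_add_mul ⟨L, hL⟩ fun P Q => ?_).continuous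
  rw [dist_eq_norm]
  exact lipEnv_le_add hf hL P Q

/-- By lower semicontinuity, the regularizations converge to the envelope. -/
theorem tendsto_lipEnv (hf : ∀ u v, |f u v| ≤ C) {P : Sym3} (hP : P ∈ K) :
    Tendsto (fun n : ℕ => lipEnv f n P) atTop (𝓝 (env f P)) := by
  have hC := nonneg_of_bound hf
  refine tendsto_order.2 ⟨fun a ha => ?_, fun a ha => Eventually.of_forall fun n =>
    (lipEnv_le_env hf n.cast_nonneg hP).trans_lt ha⟩
  obtain ⟨b, hab, hb⟩ := exists_between ha
  obtain ⟨r, hr, h⟩ := exists_lt_env_of_norm_sub_lt hf hb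
  filter_upwards [tendsto_natCast_atTop_atTop.eventually_ge_atTop ((b + 6 * C) / r)] with n hn
  refine hab.trans_le (le_ciInf fun R => ?_)
  rcases lt_or_ge ‖P - R‖ r with hlt | hge
  · have h1 := h R R.2 (by rwa [norm_sub_rev])
    have : 0 ≤ (n : ℝ) * ‖P - R‖ := by positivity
    linarith
  · rw [div_le_iff₀ hr] at hn
    have h1 := mul_le_mul_of_nonneg_left hge (Nat.cast_nonneg (α := ℝ) n)
    have h2 := (abs_le.1 (abs_env_le hf R.2)).1
    linarith

section Integral

variable {μ : Measure E3} [IsFiniteMeasure μ] {Q : E3 → Sym3}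

theorem integrable_of_ae_mem_K (hQ : AEStronglyMeasurable Q μ) (hK : ∀ᵐ x ∂μ, Q x ∈ K) :
    Integrable Q μ :=
  Integrable.of_bound hQ 1 (hK.mono fun _ h => norm_le_one_of_mem_K h)

theorem integrable_lipEnv (hf : ∀ u v, |f u v| ≤ C) (hQ : AEStronglyMeasurable Q μ)
    (hK : ∀ᵐ x ∂μ, Q x ∈ K) {L : ℝ} (hL : 0 ≤ L) : Integrable (fun x => lipEnv f L (Q x)) μ :=
  Integrable.of_bound ((continuous_lipEnv hf hL).comp_aestronglyMeasurable hQ) (6 * C)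
    (hK.mono fun _ h => abs_lipEnv_le hf hL h)

theorem integrable_env (hf : ∀ u v, |f u v| ≤ C) (hQ : AEStronglyMeasurable Q μ)
    (hK : ∀ᵐ x ∂μ, Q x ∈ K) : Integrable (fun x => env f (Q x)) μ := by
  refine Integrable.of_bound ?_ (6 * C) (hK.mono fun _ h => abs_env_le hf h)
  exact aestronglyMeasurable_of_tendsto_ae atTop
    (fun n : ℕ => (integrable_lipEnv hf hQ hK n.cast_nonneg).1)
    (hK.mono fun x hx => tendsto_lipEnv hf hx)

theorem tendsto_integral_lipEnv (hf : ∀ u v, |f u v| ≤ C) (hQ : AEStronglyMeasurable Q μ)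
    (hK : ∀ᵐ x ∂μ, Q x ∈ K) :
    Tendsto (fun n : ℕ => ∫ x, lipEnv f n (Q x) ∂μ) atTop (𝓝 (∫ x, env f (Q x) ∂μ)) :=
  tendsto_integral_of_dominated_convergence (fun _ => 6 * C)
    (fun n : ℕ => (integrable_lipEnv hf hQ hK n.cast_nonneg).1) (integrable_const _)
    (fun n => hK.mono fun _ h => abs_lipEnv_le hf n.cast_nonneg h)
    (hK.mono fun _ h => tendsto_lipEnv hf h)

/-- Jensen's inequality for the envelope, together with the fact that means lie in `K`. -/
theorem average_mem_hullEpi [NeZero μ] (hf : ∀ u v, |f u v| ≤ C) (hQ : AEStronglyMeasurable Q μ)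
    (hK : ∀ᵐ x ∂μ, Q x ∈ K) : (⨍ x, Q x ∂μ, ⨍ x, env f (Q x) ∂μ) ∈ hullEpi f := by
  have hi1 := integrable_of_ae_mem_K hQ hK
  have hi2 := integrable_env hf hQ hK
  have h := convex_hullEpi.average_mem isClosed_hullEpi (μ := μ)
    (f := fun x => (Q x, env f (Q x)))
    (hK.mono fun x hx => (mem_hullEpi_iff hf).2 ⟨hx, le_rfl⟩) (hi1.prodMk hi2)
  rwa [average_pair hi1 hi2] at h

end Integral

/-! ### Meshes -/

/-- The indices of the cells of a mesh that can meet `Ω`. -/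
def meshIndex (η : ℝ) (Ω : Set E3) : Finset Z3 := latticeFinset η (Metric.cthickening η Ω)

/-- The part of `Ω` in a cell of a mesh. -/
def piece (η : ℝ) (Ω : Set E3) (j : Z3) : Set E3 := Ω ∩ cell η j

theorem piece_subset (η : ℝ) (Ω : Set E3) (j : Z3) : piece η Ω j ⊆ Ω := Set.inter_subset_left

theorem JordanMeasurable.piece (h : JordanMeasurable Ω) (η : ℝ) (j : Z3) :
    JordanMeasurable (piece η Ω j) :=
  h.inter (null_frontier_cell η j)

theorem measurableSet_piece (h : MeasurableSet Ω) (η : ℝ) (j : Z3) :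
    MeasurableSet (piece η Ω j) :=
  h.inter (measurableSet_cell η j)

theorem pairwise_disjoint_piece {η : ℝ} (hη : 0 < η) (Ω : Set E3) :
    Pairwise (Function.onFun Disjoint (piece η Ω)) := fun _ _ hij =>
  (pairwise_disjoint_cell hη hij).mono Set.inter_subset_right Set.inter_subset_right

theorem eq_iUnion_piece {η : ℝ} (hη : 0 < η) (hΩ : Bornology.IsBounded Ω) :
    Ω = ⋃ j ∈ meshIndex η Ω, piece η Ω j := by
  refine subset_antisymm (fun x hx => ?_) (Set.iUnion₂_subset fun j _ => piece_subset η Ω j)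
  have hxc : x ∈ cell η (cellIndex η x) := (mem_cell_iff hη).2 rfl
  refine Set.mem_biUnion (x := cellIndex η x) ?_ ⟨hx, hxc⟩
  rw [Finset.mem_coe, meshIndex, mem_latticeFinset hη hΩ.cthickening]
  refine Metric.mem_cthickening_of_dist_le _ x _ _ hx ?_
  rw [dist_comm]
  exact dist_latticePoint_le hη hxc

theorem setIntegral_eq_sum_piece {E : Type*} [NormedAddCommGroup E] [NormedSpace ℝ E] {η : ℝ}
    (hη : 0 < η) (hΩ : Bornology.IsBounded Ω) (hm : MeasurableSet Ω) {q : E3 → E}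
    (hq : IntegrableOn q Ω volume) :
    ∫ x in Ω, q x = ∑ j ∈ meshIndex η Ω, ∫ x in piece η Ω j, q x := by
  conv_lhs => rw [eq_iUnion_piece hη hΩ]
  exact integral_biUnion_finset _ (fun j _ => measurableSet_piece hm η j)
    (fun i _ j _ hij => pairwise_disjoint_piece hη Ω hij)
    fun j _ => hq.mono_set (piece_subset η Ω j)

theorem sum_volume_piece {η : ℝ} (hη : 0 < η) (hΩ : Bornology.IsBounded Ω)
    (hm : MeasurableSet Ω) :
    ∑ j ∈ meshIndex η Ω, volume.real (piece η Ω j) = volume.real Ω := by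
  have h := setIntegral_eq_sum_piece hη hΩ hm (q := fun _ => (1 : ℝ))
    (integrableOn_const hΩ.measure_lt_top.ne)
  simpa [setIntegral_const] using h.symm

theorem measureReal_smul_setAverage_eq {E : Type*} [NormedAddCommGroup E] [NormedSpace ℝ E]
    [CompleteSpace E] (hA : volume A ≠ ⊤) (q : E3 → E) :
    volume.real A • ⨍ x in A, q x = ∫ x in A, q x :=
  measure_smul_setAverage q hA

/-- The mean is, up to a factor two, the constant that best approximates in `L¹`. -/
theorem setIntegral_norm_sub_average_le (hA : volume A ≠ ⊤) {q : E3 → Sym3}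
    (hq : IntegrableOn q A volume) (c : Sym3) :
    ∫ x in A, ‖q x - ⨍ y in A, q y‖ ≤ 2 * ∫ x in A, ‖q x - c‖ := by
  have hc : IntegrableOn (fun _ => c) A volume := integrableOn_const hA
  have hi : IntegrableOn (fun x => ‖q x - c‖) A volume := (hq.sub hc).norm
  set a := ⨍ y in A, q y
  have ha : IntegrableOn (fun _ => a) A volume := integrableOn_const hA
  have h1 : ∫ x in A, ‖q x - a‖ ≤ ∫ x in A, (‖q x - c‖ + ‖c - a‖) :=
    integral_mono (hq.sub ha).norm (hi.add (integrableOn_const hA))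
      fun x => norm_sub_le_norm_sub_add_norm_sub _ _ _
  rw [integral_add hi (integrableOn_const hA), setIntegral_const, smul_eq_mul] at h1
  have h2 : volume.real A * ‖c - a‖ = ‖∫ x in A, (q x - c)‖ := by
    rw [integral_sub hq hc, setIntegral_const, ← measureReal_smul_setAverage_eq hA q, ← smul_sub,
      norm_smul, Real.norm_of_nonneg measureReal_nonneg, norm_sub_rev]
  have h3 := norm_integral_le_integral_norm (μ := volume.restrict A) fun x => q x - c
  linarith

/-- On fine meshes, an integrable function is close in `L¹` to its mean values on the cells. -/
theorem exists_mesh_sum_le (hΩ : Bornology.IsBounded Ω) (hm : MeasurableSet Ω) {q : E3 → Sym3}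
    (hq : IntegrableOn q Ω volume) {δ : ℝ} (hδ : 0 < δ) :
    ∃ η > 0, ∑ j ∈ meshIndex η Ω, ∫ x in piece η Ω j, ‖q x - ⨍ y in piece η Ω j, q y‖ ≤ δ := by
  have hfin : volume Ω ≠ ⊤ := hΩ.measure_lt_top.ne
  have : IsFiniteMeasure (volume.restrict Ω) := ⟨by simpa using hfin.lt_top⟩
  obtain ⟨φ, hφc, hφ, hcont, hφi⟩ :=
    Integrable.exists_hasCompactSupport_integral_sub_le hq (by positivity : 0 < δ / 4)
  have huc : UniformContinuous φ := hφc.uniformContinuous_of_continuous hcont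
  obtain ⟨η, hη, h⟩ := Metric.uniformContinuous_iff.1 huc (δ / (4 * (volume.real Ω + 1)))
    (by positivity)
  have hη' : 0 < η / 2 := half_pos hη
  refine ⟨η / 2, hη', ?_⟩
  have hpf (j : Z3) : volume (piece (η / 2) Ω j) ≠ ⊤ :=
    measure_ne_top_of_subset (piece_subset _ _ _) hfin
  have hpiece (j : Z3) : ∫ x in piece (η / 2) Ω j, ‖q x - ⨍ y in piece (η / 2) Ω j, q y‖ ≤
      2 * ((∫ x in piece (η / 2) Ω j, ‖q x - φ x‖) +
        δ / (4 * (volume.real Ω + 1)) * volume.real (piece (η / 2) Ω j)) := by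
    have hqj := hq.mono_set (piece_subset (η / 2) Ω j)
    have hφj : IntegrableOn φ (piece (η / 2) Ω j) volume :=
      IntegrableOn.mono_set hφi (piece_subset (η / 2) Ω j)
    set c := φ (latticePoint (η / 2) j)
    refine (setIntegral_norm_sub_average_le (hpf j) hqj c).trans
      (mul_le_mul_of_nonneg_left ?_ zero_le_two)
    have hi : IntegrableOn (fun x => ‖q x - φ x‖) (piece (η / 2) Ω j) volume :=
      (hqj.sub hφj).norm
    have h1 : ∫ x in piece (η / 2) Ω j, ‖q x - c‖ ≤
        ∫ x in piece (η / 2) Ω j, (‖q x - φ x‖ + δ / (4 * (volume.real Ω + 1))) := by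
      refine setIntegral_mono_on (hqj.sub (integrableOn_const (hpf j))).norm
        (hi.add (integrableOn_const (hpf j))) (measurableSet_piece hm _ j) fun x hx => ?_
      refine (norm_sub_le_norm_sub_add_norm_sub _ (φ x) _).trans ?_
      gcongr
      rw [← dist_eq_norm]
      exact (h ((dist_latticePoint_le hη' hx.2).trans_lt (by linarith))).le
    refine h1.trans (le_of_eq ?_)
    rw [integral_add hi (integrableOn_const (hpf j)), setIntegral_const, smul_eq_mul, mul_comm]
  have hqφ : IntegrableOn (fun x => ‖q x - φ x‖) Ω volume := (hq.sub hφi).norm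
  refine (Finset.sum_le_sum fun j _ => hpiece j).trans ?_
  rw [← Finset.mul_sum, Finset.sum_add_distrib, ← Finset.mul_sum, sum_volume_piece hη' hΩ hm,
    ← setIntegral_eq_sum_piece hη' hΩ hm hqφ]
  have h2 : δ / (4 * (volume.real Ω + 1)) * volume.real Ω ≤ δ / 4 := by
    have : 0 ≤ volume.real Ω := measureReal_nonneg
    rw [div_mul_eq_mul_div, div_le_iff₀ (by positivity)]
    nlinarith
  linarith

theorem setAverage_mem_K (hA : volume A ≠ ⊤) (h0 : volume.real A ≠ 0) {q : E3 → Sym3}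
    (hq : AEStronglyMeasurable q (volume.restrict A)) (hK : ∀ᵐ x ∂volume.restrict A, q x ∈ K) :
    ⨍ x in A, q x ∈ K := by
  have : IsFiniteMeasure (volume.restrict A) := ⟨by simpa using hA.lt_top⟩
  refine convex_K.set_average_mem isClosed_K (fun h => h0 (by simp [Measure.real, h])) hA hK
    (integrable_of_ae_mem_K hq hK)

/-- The envelope at the mean values on the cells of a fine mesh nearly recovers its integral. -/
theorem exists_mesh_integral_env_le (hf : ∀ u v, |f u v| ≤ C) (hΩ : Bornology.IsBounded Ω)
    (hm : MeasurableSet Ω) {q : E3 → Sym3} (hq : AEStronglyMeasurable q (volume.restrict Ω))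
    (hK : ∀ᵐ x ∂volume.restrict Ω, q x ∈ K) {δ : ℝ} (hδ : 0 < δ) :
    ∃ η > 0, ∫ x in Ω, env f (q x) ≤ ∑ j ∈ meshIndex η Ω,
      volume.real (piece η Ω j) * env f (⨍ x in piece η Ω j, q x) + δ := by
  have hfin : volume Ω ≠ ⊤ := hΩ.measure_lt_top.ne
  have : IsFiniteMeasure (volume.restrict Ω) := ⟨by simpa using hfin.lt_top⟩
  obtain ⟨n, hn⟩ := ((tendsto_integral_lipEnv hf hq hK).eventually
    (lt_mem_nhds (by linarith : (∫ x in Ω, env f (q x)) - δ / 2 < ∫ x in Ω, env f (q x)))).exists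
  have hqi := integrable_of_ae_mem_K hq hK
  obtain ⟨η, hη, hmesh⟩ := exists_mesh_sum_le hΩ hm hqi (by positivity : 0 < δ / (2 * (n + 1)))
  refine ⟨η, hη, ?_⟩
  have hpf (j : Z3) : volume (piece η Ω j) ≠ ⊤ :=
    measure_ne_top_of_subset (piece_subset _ _ _) hfin
  have hli := integrable_lipEnv hf hq hK (L := n) n.cast_nonneg
  have hpiece (j : Z3) : ∫ x in piece η Ω j, lipEnv f n (q x) ≤
      volume.real (piece η Ω j) * env f (⨍ x in piece η Ω j, q x) +
        n * ∫ x in piece η Ω j, ‖q x - ⨍ y in piece η Ω j, q y‖ := by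
    have hqj : IntegrableOn q (piece η Ω j) volume :=
      IntegrableOn.mono_set hqi (piece_subset η Ω j)
    have : IsFiniteMeasure (volume.restrict (piece η Ω j)) := ⟨by simpa using (hpf j).lt_top⟩
    set a := ⨍ y in piece η Ω j, q y
    have hi : IntegrableOn (fun x => ‖q x - a‖) (piece η Ω j) volume :=
      (hqj.sub (integrableOn_const (hpf j))).norm
    have h1 : ∫ x in piece η Ω j, lipEnv f n (q x) ≤
        ∫ x in piece η Ω j, (lipEnv f n a + n * ‖q x - a‖) :=
      integral_mono (IntegrableOn.mono_set hli (piece_subset η Ω j))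
        ((integrableOn_const (hpf j)).add (hi.const_mul _))
        fun x => lipEnv_le_add hf n.cast_nonneg _ _
    rw [integral_add (integrable_const _) (hi.const_mul _), setIntegral_const,
      smul_eq_mul, integral_const_mul] at h1
    refine h1.trans (add_le_add_left ?_ _)
    rcases eq_or_ne (volume.real (piece η Ω j)) 0 with h0 | h0
    · rw [h0, zero_mul, zero_mul]
    · refine mul_le_mul_of_nonneg_left (lipEnv_le_env hf n.cast_nonneg ?_) measureReal_nonneg
      exact setAverage_mem_K (hpf j) h0 hqj.1
        (ae_restrict_of_ae_restrict_of_subset (piece_subset η Ω j) hK)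
  rw [setIntegral_eq_sum_piece hη hΩ hm hli] at hn
  have h2 := Finset.sum_le_sum fun j (_ : j ∈ meshIndex η Ω) => hpiece j
  rw [Finset.sum_add_distrib, ← Finset.mul_sum] at h2
  have h3 := mul_le_mul_of_nonneg_left hmesh (Nat.cast_nonneg (α := ℝ) n)
  have h4 : (n : ℝ) * (δ / (2 * (n + 1))) ≤ δ / 2 := by
    rw [mul_div_assoc', div_le_iff₀ (by positivity)]
    nlinarith
  linarith

/-- Localized lower bound: a spin field with mean tensor close to `P` on `A` has energy at least
about `3 / 2 * env f P` per unit of volume. -/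
theorem exists_eventually_le_sum_siteEnergy (hf : ∀ u v, |f u v| ≤ C) (hA : JordanMeasurable A)
    {P : Sym3} (hP : volume.real A ≠ 0 → P ∈ K) {δ : ℝ} (hδ : 0 < δ) :
    ∃ r > 0, ∀ᶠ ε in 𝓝[>] (0 : ℝ), ∀ u : Z3 → S2,
      ‖ε ^ 3 • ∑ i ∈ latticeFinset ε A, tensor (u i) - volume.real A • P‖ ≤ r →
      3 / 2 * (volume.real A * env f P) - δ ≤
        ε ^ 3 * ∑ i ∈ latticeFinset ε A, siteEnergy f u i := by
  have hC := nonneg_of_bound hf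
  set V := volume.real A
  rcases eq_or_ne V 0 with h0 | h0
  -- If `A` is negligible, the energy of its sites tends to zero.
  · refine ⟨1, one_pos, ?_⟩
    have hlim := (tendsto_card hA).mul_const (9 * C)
    change Tendsto _ _ (𝓝 (V * (9 * C))) at hlim
    rw [h0, zero_mul] at hlim
    filter_upwards [hlim.eventually (gt_mem_nhds hδ), self_mem_nhdsWithin] with ε h1 hε u _
    have hε : 0 < ε := hε
    have h2 : ∑ _i ∈ latticeFinset ε A, (-(9 * C)) ≤ ∑ i ∈ latticeFinset ε A, siteEnergy f u i :=
      Finset.sum_le_sum fun i _ => (abs_le.1 (abs_siteEnergy_le hf u i)).1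
    rw [Finset.sum_const, nsmul_eq_mul] at h2
    have h3 := mul_le_mul_of_nonneg_left h2 (by positivity : 0 ≤ ε ^ 3)
    rw [h0]
    linarith
  · have hV : 0 < V := lt_of_le_of_ne measureReal_nonneg h0.symm
    have hPK := hP h0
    obtain ⟨r, hr, h⟩ := exists_lt_env_of_norm_sub_lt hf
      (show env f P - δ / (3 * V) < env f P by
        have : 0 < δ / (3 * V) := by positivity
        linarith)
    refine ⟨V * (r / 4), by positivity, ?_⟩
    have hcard : Tendsto (fun ε : ℝ => |ε ^ 3 * (latticeFinset ε A).card - V|) (𝓝[>] 0) (𝓝 0) := by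
      have := ((tendsto_card hA).sub_const V).abs
      rwa [show volume.real A = V from rfl, sub_self, abs_zero] at this
    filter_upwards [eventually_exists_env_le hf hA hV (by positivity : 0 < r / 4),
      hcard.eventually (gt_mem_nhds (by positivity : 0 < V * (r / 4))),
      hcard.eventually (gt_mem_nhds (by positivity : 0 < δ / (18 * (C + 1)))),
      self_mem_nhdsWithin] with ε h1 h2 h2' hε u hu
    have hε : 0 < ε := hε
    obtain ⟨hne, h1⟩ := h1
    obtain ⟨R, hR, hRu, hE⟩ := h1 u
    have hN : ((latticeFinset ε A).card : ℝ) ≠ 0 := (Nat.cast_pos.2 hne.card_pos).ne'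
    set N := ((latticeFinset ε A).card : ℝ)
    set T := ∑ i ∈ latticeFinset ε A, tensor (u i)
    have hRP : ‖R - P‖ < r := by
      have e : V • (N⁻¹ • T - P) = (ε ^ 3 • T - V • P) - (ε ^ 3 * N - V) • (N⁻¹ • T) := by
        rw [sub_smul, smul_smul (ε ^ 3 * N), mul_assoc, mul_inv_cancel₀ hN]
        module
      have h3 : V * ‖N⁻¹ • T - P‖ ≤ V * (r / 4) + V * (r / 4) := by
        rw [← Real.norm_of_nonneg hV.le, ← norm_smul, Real.norm_of_nonneg hV.le, e]
        refine (norm_sub_le _ _).trans (add_le_add hu ?_)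
        rw [norm_smul, Real.norm_eq_abs]
        exact (mul_le_of_le_one_right (abs_nonneg _) (norm_mean_tensor_le _ u)).trans h2.le
      have h4 : ‖N⁻¹ • T - P‖ ≤ r / 4 + r / 4 := by
        rw [← mul_add] at h3
        exact le_of_mul_le_mul_left h3 hV
      have h5 := norm_sub_le_norm_sub_add_norm_sub R (N⁻¹ • T) P
      linarith
    have henv := h R hR hRP
    have h5 : |(ε ^ 3 * N - V) * env f R| ≤ δ / 3 := by
      rw [abs_mul]
      have h6 : |ε ^ 3 * N - V| * |env f R| ≤ δ / (18 * (C + 1)) * (6 * C) :=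
        mul_le_mul h2'.le (abs_env_le hf hR) (abs_nonneg _) (by positivity)
      refine h6.trans ?_
      rw [div_mul_eq_mul_div, div_le_iff₀ (by positivity)]
      nlinarith
    have h6 := (abs_le.1 h5).1
    have h7 : V * env f P - δ / 3 ≤ V * env f R := by
      have := mul_le_mul_of_nonneg_left henv.le hV.le
      have e : V * (env f P - δ / (3 * V)) = V * env f P - δ / 3 := by
        field_simp
      linarith
    nlinarith

/-! ### Weak* convergence -/

theorem frob_zero_left (P : Sym3) : frob 0 P = 0 := by
  rw [frob_comm]
  exact (frobL P).map_zero

/-- The symmetric matrix whose Frobenius product with `P` is the entry `P k l`. -/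
def entrySym (k l : Fin 3) : Sym3 :=
  ⟨Matrix.of fun a b => (if a = k ∧ b = l then 1 / 2 else 0) + (if a = l ∧ b = k then 1 / 2 else 0),
    by
      ext a b
      simp only [Matrix.transpose_apply, Matrix.of_apply]
      rw [add_comm]
      simp only [and_comm]⟩

theorem frob_entrySym (k l : Fin 3) (P : Sym3) : frob (entrySym k l) P = P.1 k l := by
  have hs : P.1 l k = P.1 k l := P.2.apply k l
  simp only [frob, entrySym, Matrix.of_apply, add_mul, Finset.sum_add_distrib, ite_and, ite_mul,
    zero_mul, Finset.sum_ite_eq', Finset.mem_univ, if_true, Finset.sum_ite_irrel,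
    Finset.sum_const_zero]
  rw [hs]
  ring

theorem tendsto_of_tendsto_frob {α : Type*} {l : Filter α} {P : α → Sym3} {Q : Sym3}
    (h : ∀ B, Tendsto (fun a => frob B (P a)) l (𝓝 (frob B Q))) : Tendsto P l (𝓝 Q) := by
  rw [tendsto_iff_norm_sub_tendsto_zero]
  have hent (k m : Fin 3) : Tendsto (fun a => (P a - Q).1 k m) l (𝓝 0) := by
    have := (h (entrySym k m)).sub_const (frob (entrySym k m) Q)
    simpa only [frob_entrySym, sub_self, sub_entry] using this
  have hsq : Tendsto (fun a => ‖P a - Q‖ ^ 2) l (𝓝 0) := by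
    simp only [norm_sq_eq_frob, frob]
    have := tendsto_finsetSum (Finset.univ : Finset (Fin 3)) fun k _ =>
      tendsto_finsetSum (Finset.univ : Finset (Fin 3)) fun m _ => (hent k m).mul (hent k m)
    simpa using this
  have := (Real.continuous_sqrt.tendsto 0).comp hsq
  simpa [Function.comp_def, Real.sqrt_sq] using this

theorem Interpolates.ae_mem_K {ε : ℝ} {u : Z3 → S2} {Q : LInf Ω} (h : Interpolates Ω ε u Q) :
    ∀ᵐ x ∂volume.restrict Ω, Q x ∈ K :=
  h.1.mono fun _ ⟨v, hv⟩ => hv ▸ tensor_mem_K v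

section Weak

variable [hfin : IsFiniteMeasure (volume.restrict Ω)]

theorem integrable_lInf (Q : LInf Ω) : Integrable Q (volume.restrict Ω) :=
  (Lp.memLp Q).integrable le_top

theorem WeakStarConv.tendsto_setIntegral {Qs : ℕ → LInf Ω} {Q : LInf Ω} (h : WeakStarConv Ω Qs Q)
    {s : Set E3} (hs : MeasurableSet s) :
    Tendsto (fun n => ∫ x in s, Qs n x ∂(volume.restrict Ω)) atTop
      (𝓝 (∫ x in s, Q x ∂(volume.restrict Ω))) := by
  refine tendsto_of_tendsto_frob fun B => ?_
  have key (q : LInf Ω) : ∫ x in Ω, frob (s.indicator (fun _ => B) x) (q x) =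
      frob B (∫ x in s, q x ∂(volume.restrict Ω)) := by
    rw [← frobL_apply B, ← (frobL B).integral_comp_comm (integrable_lInf q).integrableOn,
      ← integral_indicator hs]
    refine integral_congr_ae (Eventually.of_forall fun x => ?_)
    by_cases hx : x ∈ s
    · simp [hx]
    · simp [hx, frob_zero_left]
  have h1 := h (s.indicator fun _ => B) ((integrable_const B).indicator hs)
  simpa only [key] using h1

/-- Closed half-spaces that contain `K` are preserved under weak* limits. -/
theorem WeakStarConv.ae_le_of_frequently {Qs : ℕ → LInf Ω} {Q : LInf Ω}
    (h : WeakStarConv Ω Qs Q) (hK : ∃ᶠ n in atTop, ∀ᵐ x ∂volume.restrict Ω, Qs n x ∈ K)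
    (l : Sym3 →L[ℝ] ℝ) (c : ℝ) (hl : ∀ P ∈ K, c ≤ l P) :
    ∀ᵐ x ∂volume.restrict Ω, c ≤ l (Q x) := by
  have hint (q : LInf Ω) : Integrable (fun x => l (q x) - c) (volume.restrict Ω) :=
    (l.integrable_comp (integrable_lInf q)).sub (integrable_const c)
  have hpos := ae_nonneg_of_forall_setIntegral_nonneg (hint Q) fun s hs _ => ?_
  · filter_upwards [hpos] with x hx
    exact sub_nonneg.1 hx
  · have e (q : LInf Ω) : ∫ x in s, (l (q x) - c) ∂(volume.restrict Ω) =
        l (∫ x in s, q x ∂(volume.restrict Ω)) - ∫ _x in s, c ∂(volume.restrict Ω) := by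
      rw [integral_sub (l.integrable_comp (integrable_lInf q)).integrableOn
        (integrable_const c).integrableOn, l.integral_comp_comm (integrable_lInf q).integrableOn]
    have hlim := ((l.continuous.tendsto _).comp (h.tendsto_setIntegral hs)).sub_const
      (∫ _x in s, c ∂(volume.restrict Ω))
    rw [← e Q] at hlim
    refine ge_of_tendsto_of_frequently hlim (hK.mono fun n hn => ?_)
    rw [Function.comp_apply, ← e]
    refine integral_nonneg_of_ae (ae_restrict_of_ae ?_)
    filter_upwards [hn] with x hx
    exact sub_nonneg.2 (hl _ hx)

/-- `K` is an intersection of countably many closed half-spaces, hence it is preserved under weak*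
limits. -/
theorem WeakStarConv.ae_mem_K {Qs : ℕ → LInf Ω} {Q : LInf Ω} (h : WeakStarConv Ω Qs Q)
    (hK : ∃ᶠ n in atTop, ∀ᵐ x ∂volume.restrict Ω, Qs n x ∈ K) :
    ∀ᵐ x ∂volume.restrict Ω, Q x ∈ K := by
  have h1 := h.ae_le_of_frequently hK (frobL oneSym) 1 fun P hP => by
    rw [frobL_apply, ← trace_eq_frob, hP.2]
  have h2 := h.ae_le_of_frequently hK (-frobL oneSym) (-1) fun P hP => by
    rw [neg_apply, frobL_apply, ← trace_eq_frob, hP.2]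
  have h3 : ∀ᵐ x ∂volume.restrict Ω, ∀ n : ℕ,
      0 ≤ quad (TopologicalSpace.denseSeq (Fin 3 → ℝ) n) (Q x) :=
    ae_all_iff.2 fun n => h.ae_le_of_frequently hK (frobL (rankOne _)) 0
      fun P hP => ((mem_K_iff P).1 hP).1 _
  filter_upwards [h1, h2, h3] with x h1 h2 h3
  rw [neg_apply] at h2
  rw [frobL_apply, ← trace_eq_frob] at h1 h2
  refine (mem_K_iff _).2 ⟨fun v => ?_, by linarith⟩
  have hcl : IsClosed {v : Fin 3 → ℝ | 0 ≤ quad v (Q x)} := by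
    refine isClosed_le continuous_const ?_
    simp only [quad, rankOne, frob, Matrix.of_apply]
    fun_prop
  have hsub : Set.range (TopologicalSpace.denseSeq (Fin 3 → ℝ)) ⊆ {v | 0 ≤ quad v (Q x)} := by
    rintro _ ⟨n, rfl⟩
    exact h3 n
  have := closure_minimal hsub hcl
  rw [(TopologicalSpace.denseRange_denseSeq _).closure_range] at this
  exact this (Set.mem_univ v)

theorem Interpolates.norm_setIntegral_sub_le {ε : ℝ} (hε : 0 < ε) {u : Z3 → S2} {Q : LInf Ω}
    (h : Interpolates Ω ε u Q) (hA : JordanMeasurable A) (hAΩ : A ⊆ Ω) :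
    ‖(∫ x in A, Q x) - ε ^ 3 • ∑ i ∈ latticeFinset ε A, tensor (u i)‖ ≤
      2 * (1 * layer A (1 * ε)) := by
  refine QTensor.norm_setIntegral_sub_le hε hA (IntegrableOn.mono_set (integrable_lInf Q) hAΩ) ?_
    (fun i => (norm_tensor _).le) fun i hi =>
      ae_restrict_of_ae_restrict_of_subset hAΩ (h.2 i (hAΩ hi))
  exact ae_restrict_of_ae_restrict_of_subset hAΩ
    (h.ae_mem_K.mono fun _ hx => norm_le_one_of_mem_K hx)

/-- The lower bound, for all spin fields interpolated by a weak* convergent sequence. -/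
theorem eventually_le_latticeEnergy (hf : ∀ u v, |f u v| ≤ C) (hsymm : ∀ u v, f u v = f v u)
    (hΩ : JordanMeasurable Ω) (hm : MeasurableSet Ω) {ε : ℕ → ℝ} (hε : ∀ n, 0 < ε n)
    (hε0 : Tendsto ε atTop (𝓝 0)) {Qs : ℕ → LInf Ω} {Q : LInf Ω} (h : WeakStarConv Ω Qs Q)
    (hK : ∀ᵐ x ∂volume.restrict Ω, Q x ∈ K) {δ : ℝ} (hδ : 0 < δ) :
    ∀ᶠ n in atTop, ∀ u, Interpolates Ω (ε n) u (Qs n) →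
      3 / 2 * (∫ x in Ω, env f (Q x)) - δ ≤
        ε n ^ 3 * latticeEnergy f (latticeIn (ε n) Ω) u := by
  have hε1 : Tendsto ε atTop (𝓝[>] 0) :=
    tendsto_nhdsWithin_iff.2 ⟨hε0, Eventually.of_forall hε⟩
  obtain ⟨η, hη, hmesh⟩ := exists_mesh_integral_env_le hf hΩ.bounded hm (integrable_lInf Q).1 hK
    (by positivity : 0 < δ / 6)
  set J := meshIndex η Ω
  set B := piece η Ω
  have hBJ (j : Z3) : JordanMeasurable (B j) := hΩ.piece η j
  have hev : ∀ᶠ n in atTop, ∀ j ∈ J, ∀ u, Interpolates Ω (ε n) u (Qs n) →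
      3 / 2 * (volume.real (B j) * env f (⨍ x in B j, Q x)) - δ / (4 * (J.card + 1)) ≤
        ε n ^ 3 * ∑ i ∈ latticeFinset (ε n) (B j), siteEnergy f u i := by
    refine (Finset.eventually_all J).2 fun j _ => ?_
    have hBf := (hBJ j).volume_lt_top.ne
    obtain ⟨r, hr, hlow⟩ := exists_eventually_le_sum_siteEnergy (f := f) hf (hBJ j)
      (P := ⨍ x in B j, Q x)
      (fun h0 => setAverage_mem_K hBf h0
        ((integrable_lInf Q).1.mono_measure (Measure.restrict_mono_set _ (piece_subset η Ω j)))
        (ae_restrict_of_ae_restrict_of_subset (piece_subset η Ω j) hK))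
      (by positivity : 0 < δ / (4 * (J.card + 1)))
    have hconv : Tendsto (fun n => ‖(∫ x in B j, Qs n x) - ∫ x in B j, Q x‖) atTop (𝓝 0) := by
      have := h.tendsto_setIntegral (measurableSet_cell η j)
      rw [Measure.restrict_restrict (measurableSet_cell η j), Set.inter_comm] at this
      exact tendsto_iff_norm_sub_tendsto_zero.1 this
    have hlay : Tendsto (fun n => 2 * (1 * layer (B j) (1 * ε n))) atTop (𝓝 0) := by
      simpa using (((hBJ j).tendsto_layer 1).comp hε1).const_mul 2
    filter_upwards [hε1.eventually hlow, hconv.eventually (gt_mem_nhds (half_pos hr)),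
      hlay.eventually (gt_mem_nhds (half_pos hr))] with n h1 h2 h3 u hu
    refine h1 u ?_
    have h4 := hu.norm_setIntegral_sub_le (hε n) (hBJ j) (piece_subset η Ω j)
    rw [measureReal_smul_setAverage_eq hBf]
    rw [norm_sub_rev] at h4
    have h5 := norm_sub_le_norm_sub_add_norm_sub
      (ε n ^ 3 • ∑ i ∈ latticeFinset (ε n) (B j), tensor (u i)) (∫ x in B j, Qs n x)
      (∫ x in B j, Q x)
    linarith
  filter_upwards [hev, hε1.eventually (eventually_abs_latticeEnergy_sub_le hf hsymm hΩ
    (by positivity : 0 < δ / 4))] with n h1 h2 u hu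
  have h3 := (abs_le.1 (h2 u)).1
  rw [sum_latticeFinset_eq J B (fun i _ j _ hij => pairwise_disjoint_piece hη Ω hij) hΩ.bounded
    (eq_iUnion_piece hη hΩ.bounded) (hε n), Finset.mul_sum] at h3
  have h4 := Finset.sum_le_sum fun j hj => h1 j hj u hu
  rw [Finset.sum_sub_distrib, ← Finset.mul_sum, Finset.sum_const, nsmul_eq_mul] at h4
  have h5 : (J.card : ℝ) * (δ / (4 * (J.card + 1))) ≤ δ / 4 := by
    rw [mul_div_assoc', div_le_iff₀ (by positivity)]
    nlinarith
  linarith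

end Weak

/-! ### Recovery sequences -/

theorem stronglyMeasurable_tensor_cellIndex (ε : ℝ) (u : Z3 → S2) :
    StronglyMeasurable fun x : E3 => tensor (u (cellIndex ε x)) := by
  have h : Measurable (cellIndex ε) := by
    refine measurable_pi_lambda _ fun k => Int.measurable_floor.comp ?_
    have hk : Measurable fun x : E3 => x k := by fun_prop
    exact (hk.div_const ε).add_const _
  exact (StronglyMeasurable.of_discrete (f := fun i => tensor (u i))).comp_measurable h

/-- The piecewise constant interpolation of a spin field. -/
def interpolation (Ω : Set E3) (ε : ℝ) (u : Z3 → S2) : LInf Ω :=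
  (memLp_top_of_bound (stronglyMeasurable_tensor_cellIndex ε u).aestronglyMeasurable 1
    (Eventually.of_forall fun _ => (norm_tensor _).le)).toLp _

theorem coeFn_interpolation (Ω : Set E3) (ε : ℝ) (u : Z3 → S2) :
    interpolation Ω ε u =ᵐ[volume.restrict Ω] fun x => tensor (u (cellIndex ε x)) :=
  MemLp.coeFn_toLp _

theorem interpolates_interpolation {ε : ℝ} (hε : 0 < ε) (u : Z3 → S2) :
    Interpolates Ω ε u (interpolation Ω ε u) := by
  refine ⟨?_, fun i _ => ?_⟩
  · filter_upwards [coeFn_interpolation Ω ε u] with x hx using ⟨_, hx⟩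
  · filter_upwards [coeFn_interpolation Ω ε u] with x hx hxi
    rw [hx, (mem_cell_iff hε).1 hxi]

theorem exists_mem_hullEpi_mean (hf : ∀ u v, |f u v| ≤ C) (hA : volume A ≠ ⊤) {q : E3 → Sym3}
    (hq : AEStronglyMeasurable q (volume.restrict A)) (hK : ∀ᵐ x ∂volume.restrict A, q x ∈ K) :
    ∃ p ∈ hullEpi f, volume.real A • p.1 = ∫ x in A, q x ∧
      p.2 * volume.real A = ∫ x in A, env f (q x) := by
  have : IsFiniteMeasure (volume.restrict A) := ⟨by simpa using hA.lt_top⟩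
  rcases eq_or_ne (volume A) 0 with h0 | h0
  · have hr : volume.restrict A = 0 := Measure.restrict_eq_zero.2 h0
    refine ⟨_, mk_mem_hullEpi hf (tensor_mem_K ⟨EuclideanSpace.single 0 1, by simp⟩), ?_, ?_⟩ <;>
      simp [hr, Measure.real, h0]
  · have : NeZero (volume.restrict A) := ⟨fun h => h0 (Measure.restrict_eq_zero.1 h)⟩
    refine ⟨_, average_mem_hullEpi hf hq hK, measureReal_smul_setAverage_eq hA q, ?_⟩
    rw [mul_comm, ← smul_eq_mul]
    exact measureReal_smul_setAverage_eq hA fun x => env f (q x)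

section Finite

variable [hfin : IsFiniteMeasure (volume.restrict Ω)]

theorem eventually_exists_interpolation (hf : ∀ u v, |f u v| ≤ C)
    (hsymm : ∀ u v, f u v = f v u) (hΩ : JordanMeasurable Ω) (hm : MeasurableSet Ω) {Q : LInf Ω}
    (hK : ∀ᵐ x ∂volume.restrict Ω, Q x ∈ K) {η : ℝ} (hη : 0 < η) {δ : ℝ} (hδ : 0 < δ) :
    ∀ᶠ ε in 𝓝[>] (0 : ℝ), ∃ u,
      (∑ j ∈ meshIndex η Ω, ‖(∫ x in piece η Ω j, interpolation Ω ε u x) -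
        ∫ x in piece η Ω j, Q x‖ ≤ δ) ∧
      ε ^ 3 * latticeEnergy f (latticeIn ε Ω) u ≤ 3 / 2 * (∫ x in Ω, env f (Q x)) + δ := by
  set J := meshIndex η Ω
  set B := piece η Ω
  have hBJ (j : Z3) : JordanMeasurable (B j) := hΩ.piece η j
  have hBΩ (j : Z3) : B j ⊆ Ω := piece_subset η Ω j
  have hdisj : (J : Set Z3).PairwiseDisjoint B :=
    fun i _ j _ hij => pairwise_disjoint_piece hη Ω hij
  choose p hp hp1 hp2 using fun j => exists_mem_hullEpi_mean hf (hBJ j).volume_lt_top.ne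
    ((integrable_lInf Q).1.mono_measure (Measure.restrict_mono_set _ (hBΩ j)))
    (ae_restrict_of_ae_restrict_of_subset (hBΩ j) hK)
  set κ := δ / (4 * (J.card + 1))
  have hκ : 0 < κ := by positivity
  have hJκ : (J.card : ℝ) * κ ≤ δ / 4 := by
    simp only [κ]
    rw [mul_div_assoc', div_le_iff₀ (by positivity)]
    nlinarith
  have hglue := Recoverable.glue hf J B hdisj (fun j _ => hBJ j) (fun j => (p j).1)
    (fun j => (p j).2) (fun j _ => recoverable_of_mem_hullEpi hf hsymm (hBJ j) (hp j)) hκ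
  have hlay : ∀ᶠ ε in 𝓝[>] (0 : ℝ), ∀ j ∈ J, 2 * (1 * layer (B j) (1 * ε)) < κ := by
    refine (Finset.eventually_all J).2 fun j _ => ?_
    have := ((hBJ j).tendsto_layer 1).const_mul 2
    rw [mul_zero] at this
    simpa using this.eventually (gt_mem_nhds hκ)
  filter_upwards [hglue, hlay, eventually_abs_latticeEnergy_sub_le hf hsymm hΩ
    (by positivity : 0 < δ / 4), self_mem_nhdsWithin] with ε ⟨u, hu⟩ h2 h3 hε
  have hε : 0 < ε := hε
  refine ⟨u, ?_, ?_⟩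
  · have hj (j : Z3) (hj : j ∈ J) : ‖(∫ x in B j, interpolation Ω ε u x) - ∫ x in B j, Q x‖ ≤
        κ + κ := by
      have h4 := (interpolates_interpolation hε u).norm_setIntegral_sub_le hε (hBJ j) (hBΩ j)
      have h5 := (hu j hj).1
      rw [hp1 j] at h5
      refine (norm_sub_le_norm_sub_add_norm_sub _ _ _).trans
        (add_le_add (h4.trans (h2 j hj).le) h5)
    refine (Finset.sum_le_sum hj).trans ?_
    rw [Finset.sum_const, nsmul_eq_mul]
    linarith
  · have h4 := (abs_le.1 (h3 u)).2
    have h5 := Finset.sum_le_sum fun j hj => (hu j hj).2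
    simp only [hp2] at h5
    rw [Finset.sum_add_distrib, ← Finset.mul_sum, Finset.sum_const, nsmul_eq_mul,
      ← Finset.mul_sum, ← sum_latticeFinset_eq J B hdisj hΩ.bounded
      (eq_iUnion_piece hη hΩ.bounded) hε, ← setIntegral_eq_sum_piece hη hΩ.bounded hm
      (integrable_env hf (integrable_lInf Q).1 hK)] at h5
    linarith

end Finite

theorem continuous_frob : Continuous fun p : Sym3 × Sym3 => frob p.1 p.2 := by
  have he (k l : Fin 3) : Continuous fun A : Sym3 => A.1 k l := by
    have e : (fun A : Sym3 => A.1 k l) = frobL (entrySym k l) :=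
      funext fun A => (frob_entrySym k l A).symm
    rw [e]
    exact (frobL _).continuous
  refine continuous_finsetSum _ fun k _ => continuous_finsetSum _ fun l _ => ?_
  exact ((he k l).comp continuous_fst).mul ((he k l).comp continuous_snd)

theorem integrable_frob {μ : Measure E3} {φ d : E3 → Sym3} {M : ℝ} (hφ : Integrable φ μ)
    (hd : AEStronglyMeasurable d μ) (hM : ∀ᵐ x ∂μ, ‖d x‖ ≤ M) :
    Integrable (fun x => frob (φ x) (d x)) μ := by
  have hm : AEStronglyMeasurable (fun x => frob (φ x) (d x)) μ :=
    continuous_frob.comp_aestronglyMeasurable (f := fun x => (φ x, d x)) (hφ.1.prodMk hd)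
  refine (hφ.norm.mul_const M).mono' hm ?_
  filter_upwards [hM] with x hx
  exact (abs_frob_le _ _).trans (mul_le_mul_of_nonneg_left hx (norm_nonneg _))

/-- The pairing of an integrable function `φ` with a bounded function `d` is controlled by the
integrals of `d` over the cells of a mesh. -/
theorem abs_integral_frob_le (hΩ : Bornology.IsBounded Ω) (hm : MeasurableSet Ω)
    {φ ψ d : E3 → Sym3} (hφ : IntegrableOn φ Ω volume) (hψ : IntegrableOn ψ Ω volume)
    (hd : IntegrableOn d Ω volume) (hd2 : ∀ᵐ x ∂volume.restrict Ω, ‖d x‖ ≤ 2) {M ω σ η : ℝ}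
    (hη : 0 < η) (hM : ∀ x, ‖ψ x‖ ≤ M) (hω : ∀ x y, dist x y ≤ η → ‖ψ x - ψ y‖ ≤ ω)
    (hσ : ∑ j ∈ meshIndex η Ω, ‖∫ x in piece η Ω j, d x‖ ≤ σ) :
    |∫ x in Ω, frob (φ x) (d x)| ≤
      (∫ x in Ω, ‖φ x - ψ x‖) * 2 + ω * 2 * volume.real Ω + M * σ := by
  have hM0 : 0 ≤ M := (norm_nonneg _).trans (hM 0)
  have hsub : IntegrableOn (fun x => φ x - ψ x) Ω volume := hφ.sub hψ
  have h1 : |∫ x in Ω, frob (φ x - ψ x) (d x)| ≤ (∫ x in Ω, ‖φ x - ψ x‖) * 2 := by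
    rw [← integral_mul_const, ← Real.norm_eq_abs]
    refine norm_integral_le_of_norm_le (hsub.norm.mul_const 2) ?_
    filter_upwards [hd2] with x hx
    exact (abs_frob_le _ _).trans (mul_le_mul_of_nonneg_left hx (norm_nonneg _))
  have hψd := integrable_frob hψ hd.1 hd2
  have h2 : |∫ x in Ω, frob (ψ x) (d x)| ≤ ω * 2 * volume.real Ω + M * σ := by
    rw [setIntegral_eq_sum_piece hη hΩ hm hψd]
    have hj (j : Z3) : |∫ x in piece η Ω j, frob (ψ x) (d x)| ≤
        ω * 2 * volume.real (piece η Ω j) + M * ‖∫ x in piece η Ω j, d x‖ := by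
      set c := ψ (latticePoint η j)
      have hpf : volume (piece η Ω j) < ⊤ :=
        (measure_mono (piece_subset η Ω j)).trans_lt hΩ.measure_lt_top
      have hdj : IntegrableOn d (piece η Ω j) volume := hd.mono_set (piece_subset η Ω j)
      have hcd : IntegrableOn (fun x => frob c (d x)) (piece η Ω j) volume :=
        (frobL c).integrable_comp hdj
      have h3 : ∫ x in piece η Ω j, frob (ψ x) (d x) =
          (∫ x in piece η Ω j, frob (ψ x - c) (d x)) + frob c (∫ x in piece η Ω j, d x) := by
        have h4 : frob c (∫ x in piece η Ω j, d x) = ∫ x in piece η Ω j, frob c (d x) :=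
          ((frobL c).integral_comp_comm hdj).symm
        have h5 : IntegrableOn (fun x => frob (ψ x) (d x)) (piece η Ω j) volume :=
          IntegrableOn.mono_set hψd (piece_subset η Ω j)
        simp only [frob_sub_left]
        rw [h4, integral_sub h5 hcd, sub_add_cancel]
      rw [h3]
      refine (abs_add_le _ _).trans (add_le_add ?_ ?_)
      · refine norm_setIntegral_le_of_norm_le_const_ae (f := fun x => frob (ψ x - c) (d x)) hpf ?_
        filter_upwards [ae_restrict_of_ae_restrict_of_subset (piece_subset η Ω j) hd2,
          ae_restrict_mem (measurableSet_piece hm η j)] with x hx hxj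
        have h6 := hω x _ (dist_latticePoint_le hη hxj.2)
        exact (abs_frob_le _ _).trans
          (mul_le_mul h6 hx (norm_nonneg _) ((norm_nonneg _).trans h6))
      · exact (abs_frob_le _ _).trans (mul_le_mul_of_nonneg_right (hM _) (norm_nonneg _))
    refine (Finset.abs_sum_le_sum_abs _ _).trans ((Finset.sum_le_sum fun j _ => hj j).trans ?_)
    rw [Finset.sum_add_distrib, ← Finset.mul_sum, ← Finset.mul_sum, sum_volume_piece hη hΩ hm]
    exact add_le_add_right (mul_le_mul_of_nonneg_left hσ hM0) _
  have h3 : ∫ x in Ω, frob (φ x) (d x) =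
      (∫ x in Ω, frob (φ x - ψ x) (d x)) + ∫ x in Ω, frob (ψ x) (d x) := by
    rw [← integral_add (integrable_frob hsub hd.1 hd2) hψd]
    simp only [frob_sub_left, sub_add_cancel]
  rw [h3]
  exact (abs_add_le _ _).trans (by linarith)

/-- A bounded sequence converges weakly* if its integrals over the cells of finer and finer meshes
are asymptotically the right ones. -/
theorem weakStarConv_of_mesh (hΩ : Bornology.IsBounded Ω) (hm : MeasurableSet Ω) {Qs : ℕ → LInf Ω}
    {Q : LInf Ω} (hQ : ∀ᵐ x ∂volume.restrict Ω, ‖Q x‖ ≤ 1)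
    (hQs : ∀ᶠ n in atTop, ∀ᵐ x ∂volume.restrict Ω, ‖Qs n x‖ ≤ 1) {η σ : ℕ → ℝ} (hη : ∀ n, 0 < η n)
    (hη0 : Tendsto η atTop (𝓝 0)) (hσ0 : Tendsto σ atTop (𝓝 0))
    (h : ∀ᶠ n in atTop, ∑ j ∈ meshIndex (η n) Ω,
      ‖(∫ x in piece (η n) Ω j, Qs n x) - ∫ x in piece (η n) Ω j, Q x‖ ≤ σ n) :
    WeakStarConv Ω Qs Q := by
  have hfin : IsFiniteMeasure (volume.restrict Ω) := ⟨by simpa using hΩ.measure_lt_top⟩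
  intro φ hφ
  rw [Metric.tendsto_atTop']
  intro δ hδ
  obtain ⟨ψ, hψc, hψ, hcont, hψi⟩ :=
    Integrable.exists_hasCompactSupport_integral_sub_le hφ (by positivity : 0 < δ / 8)
  obtain ⟨M, hM⟩ := hψc.exists_bound_of_continuous hcont
  have huc : UniformContinuous ψ := hψc.uniformContinuous_of_continuous hcont
  obtain ⟨r, hr, hω⟩ := Metric.uniformContinuous_iff.1 huc (δ / (8 * (volume.real Ω + 1)))
    (by positivity)
  have hMσ : Tendsto (fun n => M * σ n) atTop (𝓝 0) := by simpa using hσ0.const_mul M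
  obtain ⟨N, hN⟩ := eventually_atTop.1 (((h.and hQs).and (hη0.eventually (gt_mem_nhds hr))).and
    (hMσ.eventually (gt_mem_nhds (by positivity : 0 < δ / 4))))
  refine ⟨N, fun n hn => ?_⟩
  obtain ⟨⟨⟨h1, hQn⟩, h2⟩, h3⟩ := hN n (le_of_lt hn)
  have hd : IntegrableOn (fun x => Qs n x - Q x) Ω volume :=
    (integrable_lInf (Qs n)).sub (integrable_lInf Q)
  have hd2 : ∀ᵐ x ∂volume.restrict Ω, ‖Qs n x - Q x‖ ≤ 2 := by
    filter_upwards [hQ, hQn] with x hx hx'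
    exact (norm_sub_le _ _).trans (by linarith)
  have hmesh : ∑ j ∈ meshIndex (η n) Ω, ‖∫ x in piece (η n) Ω j, (Qs n x - Q x)‖ ≤ σ n := by
    refine (Finset.sum_congr rfl fun j _ => ?_).trans_le h1
    rw [integral_sub (IntegrableOn.mono_set (integrable_lInf (Qs n)) (piece_subset _ _ _))
      (IntegrableOn.mono_set (integrable_lInf Q) (piece_subset _ _ _))]
  have key := abs_integral_frob_le hΩ hm hφ hψi hd hd2 (hη n) hM
    (fun x y hxy => by
      rw [← dist_eq_norm]
      exact (hω (lt_of_le_of_lt hxy h2)).le) hmesh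
  have hsplit : (∫ x in Ω, frob (φ x) (Qs n x)) - ∫ x in Ω, frob (φ x) (Q x) =
      ∫ x in Ω, frob (φ x) (Qs n x - Q x) := by
    rw [← integral_sub (integrable_frob hφ (integrable_lInf (Qs n)).1 hQn)
      (integrable_frob hφ (integrable_lInf Q).1 hQ)]
    simp only [frob_sub_right]
  rw [Real.dist_eq, hsplit]
  have h4 : δ / (8 * (volume.real Ω + 1)) * 2 * volume.real Ω ≤ δ / 4 := by
    have : 0 ≤ volume.real Ω := measureReal_nonneg
    rw [mul_assoc, div_mul_eq_mul_div, div_le_iff₀ (by positivity)]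
    nlinarith
  linarith

/-- A diagonal argument: properties that hold eventually, for each `m`, hold eventually with `m`
replaced by a sequence that tends to infinity. -/
theorem exists_diagonal {X : Type*} (x₀ : X) (P : ℕ → ℕ → X → Prop)
    (h : ∀ m, ∀ᶠ n in atTop, ∃ x, P m n x) :
    ∃ (k : ℕ → ℕ) (xs : ℕ → X), Tendsto k atTop atTop ∧ ∀ᶠ n in atTop, P (k n) n (xs n) := by
  classical
  let k (n : ℕ) : ℕ := Nat.findGreatest (fun m => ∃ x, P m n x) n
  refine ⟨k, fun n => if h : ∃ x, P (k n) n x then h.choose else x₀, ?_, ?_⟩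
  · refine tendsto_atTop.2 fun m => ?_
    filter_upwards [h m, eventually_ge_atTop m] with n hn hmn
    exact Nat.le_findGreatest hmn hn
  · filter_upwards [h 0] with n hn
    have hx : ∃ x, P (k n) n x := Nat.findGreatest_spec (P := fun m => ∃ x, P m n x) n.zero_le hn
    simp only [dif_pos hx]
    exact hx.choose_spec

/-! ### Gamma-convergence -/

theorem limitEnergy_of_ae_mem {Q : LInf Ω} (hK : ∀ᵐ x ∂volume.restrict Ω, Q x ∈ K) :
    limitEnergy f Ω Q = ((3 / 2 * ∫ x in Ω, env f (Q x) : ℝ) : EReal) := by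
  rw [limitEnergy, if_pos hK]
  rfl

theorem limitEnergy_of_not_ae_mem {Q : LInf Ω} (hK : ¬ ∀ᵐ x ∂volume.restrict Ω, Q x ∈ K) :
    limitEnergy f Ω Q = ⊤ := by
  rw [limitEnergy, if_neg hK]

theorem limitEnergy_le_liminf (hf : ∀ u v, |f u v| ≤ C) (hsymm : ∀ u v, f u v = f v u)
    (hΩ : JordanMeasurable Ω) (hm : MeasurableSet Ω) {ε : ℕ → ℝ} (hε : ∀ n, 0 < ε n)
    (hε0 : Tendsto ε atTop (𝓝 0)) {Qs : ℕ → LInf Ω} {Q : LInf Ω} (h : WeakStarConv Ω Qs Q) :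
    limitEnergy f Ω Q ≤ liminf (fun n => discreteEnergy f Ω (ε n) (Qs n)) atTop := by
  have hfin : IsFiniteMeasure (volume.restrict Ω) := ⟨by simpa using hΩ.volume_lt_top⟩
  by_cases hK : ∀ᵐ x ∂volume.restrict Ω, Q x ∈ K
  · rw [limitEnergy_of_ae_mem hK]
    refine le_of_forall_lt fun c hc => ?_
    obtain ⟨y, hcy, hy⟩ := EReal.lt_iff_exists_real_btwn.1 hc
    refine hcy.trans_le (le_liminf_of_le (by isBoundedDefault) ?_)
    have hy := EReal.coe_lt_coe_iff.1 hy
    filter_upwards [eventually_le_latticeEnergy hf hsymm hΩ hm hε hε0 h hK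
      (sub_pos.2 hy)] with n hn
    refine le_iInf₂ fun u hu => EReal.coe_le_coe_iff.2 ?_
    have := hn u hu
    rwa [sub_sub_cancel] at this
  · rw [limitEnergy_of_not_ae_mem hK]
    refine le_liminf_of_le (by isBoundedDefault) ?_
    have hfr : ¬ ∃ᶠ n in atTop, ∀ᵐ x ∂volume.restrict Ω, Qs n x ∈ K := fun hfr =>
      hK (h.ae_mem_K hfr)
    filter_upwards [not_frequently.1 hfr] with n hn
    exact le_iInf₂ fun u hu => (hn hu.ae_mem_K).elim

theorem exists_recovery_sequence (hf : ∀ u v, |f u v| ≤ C) (hsymm : ∀ u v, f u v = f v u)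
    (hΩ : JordanMeasurable Ω) (hm : MeasurableSet Ω) {ε : ℕ → ℝ} (hε : ∀ n, 0 < ε n)
    (hε0 : Tendsto ε atTop (𝓝 0)) (Q : LInf Ω) :
    ∃ Qs : ℕ → LInf Ω, WeakStarConv Ω Qs Q ∧
      limsup (fun n => discreteEnergy f Ω (ε n) (Qs n)) atTop ≤ limitEnergy f Ω Q := by
  have hfin : IsFiniteMeasure (volume.restrict Ω) := ⟨by simpa using hΩ.volume_lt_top⟩
  by_cases hK : ∀ᵐ x ∂volume.restrict Ω, Q x ∈ K
  · rw [limitEnergy_of_ae_mem hK]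
    set F := 3 / 2 * ∫ x in Ω, env f (Q x)
    have hε1 : Tendsto ε atTop (𝓝[>] 0) :=
      tendsto_nhdsWithin_iff.2 ⟨hε0, Eventually.of_forall hε⟩
    let τ (m : ℕ) : ℝ := 1 / ((m : ℝ) + 1)
    have hτ (m : ℕ) : 0 < τ m := Nat.one_div_pos_of_nat
    have hτ0 : Tendsto τ atTop (𝓝 0) := tendsto_one_div_add_atTop_nhds_zero_nat
    obtain ⟨k, u, hk, hu⟩ := exists_diagonal (fun _ => ⟨EuclideanSpace.single 0 1, by simp⟩)
      (fun m n (u : Z3 → S2) =>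
        (∑ j ∈ meshIndex (τ m) Ω, ‖(∫ x in piece (τ m) Ω j, interpolation Ω (ε n) u x) -
          ∫ x in piece (τ m) Ω j, Q x‖ ≤ τ m) ∧
        ε n ^ 3 * latticeEnergy f (latticeIn (ε n) Ω) u ≤ F + τ m)
      fun m => hε1.eventually
        (eventually_exists_interpolation hf hsymm hΩ hm hK (hτ m) (hτ m))
    refine ⟨fun n => interpolation Ω (ε n) (u n), ?_, ?_⟩
    · refine weakStarConv_of_mesh hΩ.bounded hm (hK.mono fun _ h => norm_le_one_of_mem_K h)
        (Eventually.of_forall fun n => ?_) (fun n => hτ (k n)) (hτ0.comp hk) (hτ0.comp hk)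
        (hu.mono fun n hn => hn.1)
      exact (interpolates_interpolation (hε n) (u n)).ae_mem_K.mono
        fun _ h => norm_le_one_of_mem_K h
    · refine le_of_forall_gt fun c hc => ?_
      obtain ⟨y, hy, hyc⟩ := EReal.lt_iff_exists_real_btwn.1 hc
      refine lt_of_le_of_lt (limsup_le_of_le (by isBoundedDefault) ?_) hyc
      have hy := EReal.coe_lt_coe_iff.1 hy
      filter_upwards [hu, (hτ0.comp hk).eventually (gt_mem_nhds (sub_pos.2 hy))] with n h1 h2
      refine (iInf₂_le (u n) (interpolates_interpolation (hε n) (u n))).trans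
        (EReal.coe_le_coe_iff.2 ?_)
      have h3 : τ (k n) < y - F := h2
      linarith [h1.2]
  · refine ⟨fun _ => Q, fun φ _ => tendsto_const_nhds, ?_⟩
    rw [limitEnergy_of_not_ae_mem hK]
    exact le_top

end QTensor

end

theorem theorem3p14
    (Ω : Set QTensor.E3) (hopen : IsOpen Ω) (hbdd : Bornology.IsBounded Ω)
    (hlip : QTensor.HasLipschitzBoundary Ω)
    (f : QTensor.S2 → QTensor.S2 → ℝ)
    (hsymm : ∀ u v, f u v = f v u)
    (heven : ∀ u v, f u (-v) = f u v)
    (hbounded : ∃ C : ℝ, ∀ u v, |f u v| ≤ C) :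
    (∀ Q ∈ QTensor.K, QTensor.envelope (QTensor.fHat f) Q ≠ ⊤ ∧
      QTensor.envelope (QTensor.fHat f) Q ≠ ⊥) ∧
    (∀ Q : QTensor.LInf Ω, (∀ᵐ x ∂(volume.restrict Ω), Q x ∈ QTensor.K) →
      IntegrableOn (fun x => (QTensor.envelope (QTensor.fHat f) (Q x)).toReal) Ω volume) ∧
    QTensor.GammaConverges (QTensor.WeakStarConv Ω) (QTensor.discreteEnergy f Ω)
      (QTensor.limitEnergy f Ω) ∧
    (∀ Q ∈ QTensor.K, QTensor.IsHomogenizedValue f Q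
      (((3 / 2 : ℝ) : EReal) * QTensor.envelope (QTensor.fHat f) Q)) := by
  obtain ⟨C, hC⟩ := hbounded
  have hΩ : QTensor.JordanMeasurable Ω :=
    ⟨hbdd, QTensor.null_frontier_of_hasLipschitzBoundary hopen hlip⟩
  have hfin : IsFiniteMeasure (volume.restrict Ω) := ⟨by simpa using hΩ.volume_lt_top⟩
  refine ⟨fun Q hQ => ⟨QTensor.envelope_ne_top hC hQ, QTensor.envelope_ne_bot hC Q⟩,
    fun Q hK => QTensor.integrable_env hC (QTensor.integrable_lInf Q).1 hK, ?_,
    fun Q hQ => QTensor.isHomogenizedValue hC hsymm hQ⟩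
  intro ε hε hε0
  exact ⟨fun Q Qs h => QTensor.limitEnergy_le_liminf hC hsymm hΩ hopen.measurableSet hε hε0 h,
    fun Q => QTensor.exists_recovery_sequence hC hsymm hΩ hopen.measurableSet hε hε0 Q⟩
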